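/- Let $K$ be a field, $n\ge 2$, and let $\varepsilon$ be an indeterminate. Let $A(\varepsilon)=(A_1,\dots,A_n)$ be the configuration of collinear cameras $$A_i=\begin{pmatrix}1&1&0&0\\1&0&1&0\\ \varepsilon^{n-i}&0&0&1\end{pmatrix}\qquad(1\le i\le n)$$ over $K(\varepsilon)$. The multiview variety $V_{A(\varepsilon)}\subset(\mathbb P^2)^n$ is the Zariski closure (over the algebraic closure of $K(\varepsilon)$) of the image of the rational map $\mathbb P^3\dashrightarrow(\mathbb P^2)^n$, $q\mapsto(A_1q,\dots,A_nq)$. The multiview ideal $J_{A(\varepsilon)}\subset K(\varepsilon)[x,y,z]=K(\varepsilon)[x_i,y_i,z_i:1\le i\le n]$ is the ideal of all polynomials that vanish on $V_{A(\varepsilon)}$. Let $\mathcal G_n\subset K(\varepsilon)[x,y,z]$ be the set consisting of the quadrics $x_iy_j-x_jy_i$ for $1\le i<j\le n$ and, for all $1\le i<j<k\le n$, of the three cubics $$\begin{aligned} &(\varepsilon^{n-k}-\varepsilon^{n-i})\,x_iz_jx_k+(\varepsilon^{n-j}-\varepsilon^{n-k})\,z_ix_jx_k+(\varepsilon^{n-i}-\varepsilon^{n-j})\,x_ix_jz_k,\\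 &(\varepsilon^{n-k}-\varepsilon^{n-i})\,y_iz_jy_k+(\varepsilon^{n-j}-\varepsilon^{n-k})\,z_iy_jy_k+(\varepsilon^{n-i}-\varepsilon^{n-j})\,y_iy_jz_k,\\ &(\varepsilon^{n-k}-\varepsilon^{n-i})\,y_iz_jx_k+(\varepsilon^{n-j}-\varepsilon^{n-k})\,z_iy_jx_k+(\varepsilon^{n-i}-\varepsilon^{n-j})\,y_ix_jz_k. \end{aligned}$$ In $K[x,y,z]$ let $$L_n=\langle x_iy_j-x_jy_i: i<j\rangle+\langle x_iz_jx_k-z_ix_jx_k,\ y_iz_jy_k-z_iy_jy_k,\ y_iz_jx_k-z_iy_jx_k: i<j<k\rangle,$$ $$N_n=\langle x_iy_j: i<j\rangle+\langle x_iz_jx_k,\ y_iz_jy_k,\ y_iz_jx_k: i<j<k\rangle.$$ Let $R\subset K(\varepsilon)$ be the valuation ring of the rational functions whose order of vanishing at $\varepsilon=0$ is nonnegative. The special fiber of an ideal $I\subset K(\varepsilon)[x,y,z]$ is the image of $I\cap R[x,y,z]$ in $K[x,y,z]$ under evaluation of the coefficients at $\varepsilon=0$. Then: (a) $J_{A(\varepsilon)}$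 is generated by $\mathcal G_n$. (b) The special fiber of $J_{A(\varepsilon)}$ at $\varepsilon=0$ is $L_n$. (c) The initial ideal of $L_n$ with respect to the lexicographic order with $x_1\succ\cdots\succ x_n\succ y_1\succ\cdots\succ y_n\succ z_1\succ\cdots\succ z_n$ is $N_n$. This is a two-step flat degeneration $J_{A(\varepsilon)}\to L_n\to N_n$, in the following sense. First, $R[x,y,z]/(J_{A(\varepsilon)}\cap R[x,y,z])$ is flat over $R$, and $J_{A(\varepsilon)}\cap R[x,y,z]$ generates $J_{A(\varepsilon)}$ over $K(\varepsilon)$. Second, there are weights $w_v\in\mathbb N$ for the $3n$ unknowns $v$ such that the ideal $\mathcal I\subset K[t][x,y,z]$ of all polynomials that lie in $L_n\cdot K[t][x,y,z]$ after the substitution $v\mapsto t^{w_v}v$ for all unknowns $v$ has these properties: $K[t][x,y,z]/\mathcal I$ is flat over $K[t]$; for every $c\in K\setminus\{0\}$ the fiber of $\mathcal I$ at $t=c$ is the ideal of all polynomials that lie in $L_n$ after the substitution $v\mapsto c^{w_v}v$; and the fiber of $\mathcal I$ at $t=0$ is $N_n$. -/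

import Mathlib

open scoped LinearAlgebra.Projectivization

namespace Multiview

/-! ### Unknowns

The `3n` unknowns are indexed by pairs (coordinate, camera) with the lexicographic order of pairs,
so that the order of the index set lists them as `x₁, …, xₙ, y₁, …, yₙ, z₁, …, zₙ`.
Camera number `i ∈ {1, …, n}` is the element `i - 1` of `Fin n`. -/

/-- Index set of the unknowns: `(0, i)`, `(1, i)`, `(2, i)` stand for `xᵢ`, `yᵢ`, `zᵢ`. -/
abbrev Var (n : ℕ) : Type := Fin 3 ×ₗ Fin n

section Unknowns

variable {R : Type*} [CommRing R] {n : ℕ}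

noncomputable def x (i : Fin n) : MvPolynomial (Var n) R := MvPolynomial.X (toLex (0, i))

noncomputable def y (i : Fin n) : MvPolynomial (Var n) R := MvPolynomial.X (toLex (1, i))

noncomputable def z (i : Fin n) : MvPolynomial (Var n) R := MvPolynomial.X (toLex (2, i))

end Unknowns

/-! ### Multiview varieties and multiview ideals -/

section Multiview

variable {F : Type*} [Field F] {n : ℕ}

/-- The image of the rational map `φ_A : ℙ³ ⇢ (ℙ²)ⁿ`, `q ↦ (A₁q, …, Aₙq)`, which is defined at the
points `q` with `Aᵢ q ≠ 0` for all `i`. -/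
def cameraImage (A : Fin n → Matrix (Fin 3) (Fin 4) F) : Set (Fin n → ℙ F (Fin 3 → F)) :=
  {P | ∃ q : Fin 4 → F, q ≠ 0 ∧ ∃ h : ∀ i, (A i).mulVec q ≠ 0,
    ∀ i, P i = Projectivization.mk F ((A i).mulVec q) (h i)}

/-- The polynomial `f` vanishes at the point `P` of `(ℙ²)ⁿ`: it vanishes at every choice
`(p₁, …, pₙ)` of homogeneous coordinates of `P`. -/
def VanishesAt (f : MvPolynomial (Var n) F) (P : Fin n → ℙ F (Fin 3 → F)) : Prop :=
  ∀ (p : Fin n → Fin 3 → F) (hp : ∀ i, p i ≠ 0),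
    (∀ i, Projectivization.mk F (p i) (hp i) = P i) →
      MvPolynomial.eval (fun v : Var n => p (ofLex v).2 (ofLex v).1) f = 0

/-- The ideal of all polynomials that vanish on a subset of `(ℙ²)ⁿ`. -/
def vanishingIdeal (S : Set (Fin n → ℙ F (Fin 3 → F))) : Ideal (MvPolynomial (Var n) F) where
  carrier := {f | ∀ P ∈ S, VanishesAt f P}
  zero_mem' := fun _ _ _ _ _ => map_zero _
  add_mem' := fun {f g} hf hg P hP p hp h => by
    rw [map_add, hf P hP p hp h, hg P hP p hp h, add_zero]
  smul_mem' := fun c f hf P hP p hp h => by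
    rw [smul_eq_mul, map_mul, hf P hP p hp h, mul_zero]

/-- The Zariski closure of a subset of `(ℙ²)ⁿ`: the common zeros of the polynomials that vanish on
the set. -/
def zariskiClosure (S : Set (Fin n → ℙ F (Fin 3 → F))) : Set (Fin n → ℙ F (Fin 3 → F)) :=
  {P | ∀ f ∈ vanishingIdeal S, VanishesAt f P}

/-- The multiview variety `V_A`, for cameras over an algebraically closed field. -/
def multiviewVariety [IsAlgClosed F] (A : Fin n → Matrix (Fin 3) (Fin 4) F) :
    Set (Fin n → ℙ F (Fin 3 → F)) :=
  zariskiClosure (cameraImage A)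

/-- The multiview ideal `J_A` of cameras over a field `F`: the polynomials with coefficients in `F`
that vanish on the multiview variety, a set of points over the algebraic closure of `F`. -/
noncomputable def multiviewIdeal (A : Fin n → Matrix (Fin 3) (Fin 4) F) :
    Ideal (MvPolynomial (Var n) F) :=
  (vanishingIdeal (multiviewVariety
    (fun i => (A i).map (algebraMap F (AlgebraicClosure F))))).comap
      (MvPolynomial.map (algebraMap F (AlgebraicClosure F)))

end Multiview

/-! ### The collinear cameras and the three ideals -/

section Ideals

variable (K : Type*) [Field K]

/-- The scalar `ε ^ (n - i)` in `K(ε)`, where `i ∈ {1, …, n}` is the number of the camera. -/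
noncomputable def epsPow {n : ℕ} (i : Fin n) : RatFunc K :=
  (RatFunc.X : RatFunc K) ^ (n - (i.val + 1))

/-- The camera configuration `A(ε)`. -/
noncomputable def collinearCameras (n : ℕ) : Fin n → Matrix (Fin 3) (Fin 4) (RatFunc K) :=
  fun i => !![1, 1, 0, 0;
              1, 0, 1, 0;
              epsPow K i, 0, 0, 1]

/-- Coefficients of the trinomial cubics: `threeTerm i j k p q r` is
`(ε^(n-k) - ε^(n-i)) p + (ε^(n-j) - ε^(n-k)) q + (ε^(n-i) - ε^(n-j)) r`. -/
noncomputable def threeTerm {n : ℕ} (i j k : Fin n) (p q r : MvPolynomial (Var n) (RatFunc K)) :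
    MvPolynomial (Var n) (RatFunc K) :=
  MvPolynomial.C (epsPow K k - epsPow K i) * p + MvPolynomial.C (epsPow K j - epsPow K k) * q
    + MvPolynomial.C (epsPow K i - epsPow K j) * r

/-- The set `𝒢ₙ` of quadrics and trinomial cubics in `K(ε)[x,y,z]`. -/
def quadricsAndCubics (n : ℕ) : Set (MvPolynomial (Var n) (RatFunc K)) :=
  {f | ∃ i j : Fin n, i < j ∧ f = x i * y j - x j * y i} ∪
  {f | ∃ i j k : Fin n, i < j ∧ j < k ∧
    (f = threeTerm K i j k (x i * z j * x k) (z i * x j * x k) (x i * x j * z k) ∨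
     f = threeTerm K i j k (y i * z j * y k) (z i * y j * y k) (y i * y j * z k) ∨
     f = threeTerm K i j k (y i * z j * x k) (z i * y j * x k) (y i * x j * z k))}

/-- The binomial ideal `Lₙ` in `K[x,y,z]`. -/
noncomputable def binomialIdeal (n : ℕ) : Ideal (MvPolynomial (Var n) K) :=
  Ideal.span {f | ∃ i j : Fin n, i < j ∧ f = x i * y j - x j * y i} +
  Ideal.span {f | ∃ i j k : Fin n, i < j ∧ j < k ∧
    (f = x i * z j * x k - z i * x j * x k ∨
     f = y i * z j * y k - z i * y j * y k ∨
     f = y i * z j * x k - z i * y j * x k)}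

/-- The monomial ideal `Nₙ` in `K[x,y,z]`. -/
noncomputable def monomialIdeal (n : ℕ) : Ideal (MvPolynomial (Var n) K) :=
  Ideal.span {f | ∃ i j : Fin n, i < j ∧ f = x i * y j} +
  Ideal.span {f | ∃ i j k : Fin n, i < j ∧ j < k ∧
    (f = x i * z j * x k ∨ f = y i * z j * y k ∨ f = y i * z j * x k)}

end Ideals

/-! ### The special fiber at `ε = 0` -/

section SpecialFiber

variable (K : Type*) [Field K]

/-- The valuation ring of `K(ε)` for the order of vanishing at `ε = 0`
(in Mathlib's multiplicative notation, `val c ≥ 0` reads `v c ≤ 1`). -/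
noncomputable def valRing : ValuationSubring (RatFunc K) :=
  ((Polynomial.idealX K).valuation (RatFunc K)).valuationSubring

/-- Rational functions of nonnegative valuation have no pole at `ε = 0`. -/
theorem eval_denom_ne_zero {c : RatFunc K} (hc : c ∈ valRing K) :
    Polynomial.eval₂ (RingHom.id K) 0 c.denom ≠ 0 := by
  intro h0
  have h0' : Polynomial.eval 0 c.denom = 0 := h0
  have hd : (Polynomial.X : Polynomial K) ∣ c.denom := by
    rw [Polynomial.X_dvd_iff, Polynomial.coeff_zero_eq_eval_zero]; exact h0'
  have hn : ¬ (Polynomial.X : Polynomial K) ∣ c.num := fun hn =>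
    Polynomial.not_isUnit_X ((RatFunc.isCoprime_num_denom c).isUnit_of_dvd' hn hd)
  have hmem : ∀ p : Polynomial K, p ∈ (Polynomial.idealX K).asIdeal ↔ Polynomial.X ∣ p := by
    intro p; rw [Polynomial.idealX_span, Ideal.mem_span_singleton]
  have vd : (Polynomial.idealX K).valuation (RatFunc K)
      (algebraMap (Polynomial K) (RatFunc K) c.denom) < 1 := by
    rw [IsDedekindDomain.HeightOneSpectrum.valuation_lt_one_iff_mem, hmem]; exact hd
  have vn : ¬ (Polynomial.idealX K).valuation (RatFunc K)
      (algebraMap (Polynomial K) (RatFunc K) c.num) < 1 := by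
    rw [IsDedekindDomain.HeightOneSpectrum.valuation_lt_one_iff_mem, hmem]; exact hn
  apply vn
  have hdz : algebraMap (Polynomial K) (RatFunc K) c.denom ≠ 0 :=
    RatFunc.algebraMap_ne_zero c.denom_ne_zero
  have hc' : (Polynomial.idealX K).valuation (RatFunc K) c ≤ 1 := hc
  have e : algebraMap (Polynomial K) (RatFunc K) c.num
      = c * algebraMap (Polynomial K) (RatFunc K) c.denom := by
    rw [eq_comm, ← eq_div_iff hdz, RatFunc.num_div_denom]
  rw [e, map_mul]
  exact lt_of_le_of_lt (mul_le_of_le_one_left' hc') vd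

/-- Evaluation at `ε = 0`, the natural map from the valuation ring to its residue field `K`. -/
noncomputable def evalZero : valRing K →+* K where
  toFun c := RatFunc.eval (RingHom.id K) 0 (c : RatFunc K)
  map_one' := RatFunc.eval_one _ _
  map_zero' := RatFunc.eval_zero _ _
  map_add' c d := RatFunc.eval_add _ _ (eval_denom_ne_zero K c.2) (eval_denom_ne_zero K d.2)
  map_mul' c d := RatFunc.eval_mul _ _ (eval_denom_ne_zero K c.2) (eval_denom_ne_zero K d.2)

variable {K} {n : ℕ}

/-- The intersection of an ideal of `K(ε)[x,y,z]` with the polynomials over the valuation ring. -/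
noncomputable def integralPart (I : Ideal (MvPolynomial (Var n) (RatFunc K))) :
    Ideal (MvPolynomial (Var n) (valRing K)) :=
  I.comap (MvPolynomial.map (valRing K).subtype)

/-- The special fiber of an ideal of `K(ε)[x,y,z]` at `ε = 0`: the image of its integral part under
coefficientwise evaluation at `ε = 0` (a surjective ring homomorphism, so that the image is an
ideal). -/
noncomputable def specialFiber (I : Ideal (MvPolynomial (Var n) (RatFunc K))) :
    Ideal (MvPolynomial (Var n) K) :=
  (integralPart I).map (MvPolynomial.map (evalZero K))

end SpecialFiber

/-! ### Initial ideals and the associated one-parameter families -/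

section Initial

variable {K : Type*} [Field K] {n : ℕ}

/-- The initial ideal, generated by the leading terms of the elements of the ideal. -/
noncomputable def initialIdeal (m : MonomialOrder (Var n)) (I : Ideal (MvPolynomial (Var n) K)) :
    Ideal (MvPolynomial (Var n) K) :=
  Ideal.span (m.leadingTerm '' (I : Set (MvPolynomial (Var n) K)))

/-- The substitution that multiplies the unknown number `v` by the scalar `s v`. -/
noncomputable def rescale {R : Type*} [CommRing R] (s : Var n → R) :
    MvPolynomial (Var n) R →ₐ[R] MvPolynomial (Var n) R :=
  MvPolynomial.aeval (fun v => MvPolynomial.C (s v) * MvPolynomial.X v)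

/-- The family of ideals over the affine line with parameter `t` that a weight vector `w` induces:
the polynomials over `K[t]` which lie in the extension of `I` to `K[t][x,y,z]` after each unknown
number `v` is replaced by its product with `t ^ w v`. -/
noncomputable def weightFamily (w : Var n → ℕ) (I : Ideal (MvPolynomial (Var n) K)) :
    Ideal (MvPolynomial (Var n) (Polynomial K)) :=
  (I.map (MvPolynomial.map (Polynomial.C : K →+* Polynomial K))).comap
    (rescale (fun v => (Polynomial.X : Polynomial K) ^ w v)).toRingHom

/-- The fiber at `t = c` of a family of ideals over the affine line. -/
noncomputable def fiberAt (c : K) (I : Ideal (MvPolynomial (Var n) (Polynomial K))) :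
    Ideal (MvPolynomial (Var n) K) :=
  I.map (MvPolynomial.map (Polynomial.evalRingHom c))

end Initial

end Multiview

/-!
The proof runs through the monomials outside `Nₙ`, called standard here. Their exponents have no
`xᵢ yⱼ` with `i < j`, and no `zⱼ` strictly between two cameras that occur with an `x` or a `y`.
They form a basis modulo each ideal of the degeneration, over the ring over which it lives, and
this single fact yields all parts of the theorem.

*Independence* is shown only once, for `J_{A(ε)}`. After a linear change of coordinates of `ℙ³` the
multiview variety is parametrized by `xᵢ ↦ λᵢ a`, `yᵢ ↦ λᵢ b`, `zᵢ ↦ λᵢ (T + ε^(n-i))`. The standard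
monomials with a given image monomial in `λ, a, b` are then told apart by a factor in `T`, a product
of powers of the `n` distinct linear forms `T + ε^(n-i)`. These products are independent by a
triangular argument: a standard monomial is determined by the largest camera `k` with an `x` or a `y` and by
the number of `x`s and `y`s there, so that a unique one has the lowest power of `T + ε^(n-k)`
(`eq_empty_of_sum_lineFactor_eq_zero`, `eq_zero_of_mem_multiviewIdeal`).

*Spanning* (`restrictSupport_sup_eq_top`): each generator of `Lₙ` is a binomial that exchanges a
monomial of `Nₙ` for one of the same degree which is smaller both in the lexicographic order and
for the weights `2 (n - i), n - i, 0` of `xᵢ, yᵢ, zᵢ`. So standard monomials span modulo `Lₙ`. The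
cubics of `𝒢ₙ`, divided by `ε^(n-k)`, have coefficients in the valuation ring `R` and agree with
the binomials modulo `ε`, so that Nakayama's lemma in each degree gives spanning over `R`.

Together these identify `J_{A(ε)} ∩ R[x,y,z]` with the ideal over `R` generated by the quadrics and
the rescaled cubics (`integralPart_eq`), which gives (a), (b) and the first flatness. Independence
modulo `Lₙ` follows by lifting a relation to `R` (`eq_zero_of_mem_binomialIdeal`), and since the
exchanges lower exponents lexicographically, no leading monomial of `Lₙ` is standard, which is (c).
The weight family is generated by the binomials with the power of `t` that makes up for the
difference of weights (`weightFamily_eq_span`); the standard monomials are again a basis modulo it,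
and its fibers can be read off from the generators.
-/

namespace Multiview

open MvPolynomial

/-! ### Exponents, exchange relations and standard exponents -/

section Exponents

variable {n : ℕ}

/-- The exponent of the single unknown number `(c, i)`. -/
noncomputable def expo (c : Fin 3) (i : Fin n) : Var n →₀ ℕ := Finsupp.single (toLex (c, i)) 1

/-- The pairs of exponents of the binomials that generate `Lₙ`; the first exponent of each pair is
that of the corresponding generator of `Nₙ`. The indices `p` and `q` of a cubic choose the letters
in `uᵢ zⱼ vₖ - zᵢ uⱼ vₖ`; the combination `u = x`, `v = y` is absent, since `xᵢ yₖ` already lies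
in `Nₙ`. -/
inductive Exchange : (Var n →₀ ℕ) → (Var n →₀ ℕ) → Prop
  | quadric {i j : Fin n} (hij : i < j) : Exchange (expo 0 i + expo 1 j) (expo 0 j + expo 1 i)
  | cubic {p q : Fin 3} (hqp : q ≤ p) (hp : p < 2) {i j k : Fin n} (hij : i < j) (hjk : j < k) :
      Exchange (expo p i + expo 2 j + expo q k) (expo 2 i + expo p j + expo q k)

/-- The exponents of the monomials outside `Nₙ`. -/
def standardExponents (n : ℕ) : Set (Var n →₀ ℕ) :=
  {m | ∀ a b, Exchange a b → ¬ a ≤ m}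

/-- The total degree of an exponent in the unknowns `xᵢ`, `yᵢ` of camera `i`. -/
def planar (m : Var n →₀ ℕ) (i : Fin n) : ℕ := m (toLex (0, i)) + m (toLex (1, i))

theorem toLex_exchange_lt {c c' : Fin 3} (hc : c < c') {i j : Fin n} (hij : i < j) :
    toLex (expo c j + expo c' i) < toLex (expo c i + expo c' j) := by
  rw [Finsupp.Lex.lt_iff]
  refine ⟨toLex (c, i), fun v hv => ?_, ?_⟩
  · obtain ⟨⟨a, b⟩, rfl⟩ := toLex.surjective v
    rw [Prod.Lex.toLex_lt_toLex] at hv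
    have h1 : (toLex (c, j) : Var n) ≠ toLex (a, b) := by
      intro h; simp only [EmbeddingLike.apply_eq_iff_eq, Prod.mk.injEq] at h
      rcases hv with hv | hv <;> grind
    have h2 : (toLex (c', i) : Var n) ≠ toLex (a, b) := by
      intro h; simp only [EmbeddingLike.apply_eq_iff_eq, Prod.mk.injEq] at h
      rcases hv with hv | hv <;> grind
    have h3 : (toLex (c, i) : Var n) ≠ toLex (a, b) := by
      intro h; simp only [EmbeddingLike.apply_eq_iff_eq, Prod.mk.injEq] at h
      rcases hv with hv | hv <;> grind
    have h4 : (toLex (c', j) : Var n) ≠ toLex (a, b) := by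
      intro h; simp only [EmbeddingLike.apply_eq_iff_eq, Prod.mk.injEq] at h
      rcases hv with hv | hv <;> grind
    simp [expo, h1, h2, h3, h4]
  · have h1 : (toLex (c, j) : Var n) ≠ toLex (c, i) := by simp [hij.ne']
    have h2 : (toLex (c', i) : Var n) ≠ toLex (c, i) := by simp [hc.ne']
    simp [expo, h1, h2]

theorem Exchange.lex_lt {a b : Var n →₀ ℕ} (h : Exchange a b) : toLex b < toLex a := by
  cases h with
  | quadric hij => exact toLex_exchange_lt (by decide) hij
  | @cubic p q hqp hp i j k hij hjk =>
    rw [add_comm (expo 2 i), toLex_add, toLex_add _ (expo q k)]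
    exact add_lt_add_left (toLex_exchange_lt hp hij) _

/-- Both sides of an exchange have the same total degree. -/
theorem Exchange.degree_eq {a b : Var n →₀ ℕ} (h : Exchange a b) : b.degree = a.degree := by
  cases h <;> simp [expo]

/-- Weights for which the first monomial of each exchange has the larger weight:
`2 (n - i)` for `xᵢ`, `n - i` for `yᵢ` and `0` for `zᵢ`. -/
def unknownWeight (n : ℕ) (v : Var n) : ℕ :=
  (2 - ((ofLex v).1 : ℕ)) * (n - ((ofLex v).2 + 1 : ℕ))

/-- The weight of an exponent. -/
noncomputable def weight (m : Var n →₀ ℕ) : ℕ := Finsupp.weight (unknownWeight n) m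

theorem weight_add (a b : Var n →₀ ℕ) : weight (a + b) = weight a + weight b := map_add _ _ _

theorem Exchange.weight_lt {a b : Var n →₀ ℕ} (h : Exchange a b) : weight b < weight a := by
  have key : ∀ (c : Fin 3) (i : Fin n), weight (expo c i) = (2 - (c : ℕ)) * (n - (i + 1 : ℕ)) := by
    intro c i
    simp [weight, expo, unknownWeight, Finsupp.weight_single]
  cases h with
  | @quadric i j hij =>
    simp only [weight_add, key]
    have : (i : ℕ) < j := hij
    have := j.2
    simp; omega
  | @cubic p q hqp hp i j k hij hjk =>
    simp only [weight_add, key]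
    have h1 : (i : ℕ) < j := hij
    have h2 : (j : ℕ) < k := hjk
    have h3 := k.2
    have h4 : 0 < 2 - (p : ℕ) := by
      have : (p : ℕ) < 2 := hp
      omega
    have := Nat.mul_lt_mul_of_pos_left (show n - (j + 1 : ℕ) < n - (i + 1 : ℕ) by omega) h4
    simp; omega

theorem expo_add_expo_le {m : Var n →₀ ℕ} {c d : Fin 3} {i j : Fin n} (hij : i ≠ j)
    (h1 : 0 < m (toLex (c, i))) (h2 : 0 < m (toLex (d, j))) : expo c i + expo d j ≤ m := by
  intro v
  have hne : (toLex (c, i) : Var n) ≠ toLex (d, j) := by simp [hij]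
  simp only [expo, Finsupp.coe_add, Pi.add_apply, Finsupp.single_apply]
  split_ifs <;> grind

theorem expo_add_expo_add_expo_le {m : Var n →₀ ℕ} {c d e : Fin 3} {i j k : Fin n} (hij : i ≠ j)
    (hik : i ≠ k) (hjk : j ≠ k) (h1 : 0 < m (toLex (c, i))) (h2 : 0 < m (toLex (d, j)))
    (h3 : 0 < m (toLex (e, k))) : expo c i + expo d j + expo e k ≤ m := by
  intro v
  have hne : (toLex (c, i) : Var n) ≠ toLex (d, j) := by simp [hij]
  have hne' : (toLex (c, i) : Var n) ≠ toLex (e, k) := by simp [hik]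
  have hne'' : (toLex (d, j) : Var n) ≠ toLex (e, k) := by simp [hjk]
  simp only [expo, Finsupp.coe_add, Pi.add_apply, Finsupp.single_apply]
  split_ifs <;> grind

theorem y_eq_zero_of_standard {m : Var n →₀ ℕ} (hm : m ∈ standardExponents n) {i j : Fin n}
    (hij : i < j) (hx : 0 < m (toLex (0, i))) : m (toLex (1, j)) = 0 := by
  by_contra h
  exact hm _ _ (.quadric hij) (expo_add_expo_le hij.ne hx (Nat.pos_of_ne_zero h))

/-- Between two cameras that occur with an `x` or a `y`, a standard monomial has no `z`. -/
theorem z_eq_zero_of_standard {m : Var n →₀ ℕ} (hm : m ∈ standardExponents n) {i j k : Fin n}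
    (hij : i < j) (hjk : j < k) (hi : 0 < planar m i) (hk : 0 < planar m k) :
    m (toLex (2, j)) = 0 := by
  by_contra h
  have hz := Nat.pos_of_ne_zero h
  have aux : ∀ p q : Fin 3, q ≤ p → p < 2 → 0 < m (toLex (p, i)) → ¬ 0 < m (toLex (q, k)) :=
    fun p q hqp hp h1 h2 => hm _ _ (.cubic hqp hp hij hjk)
      (expo_add_expo_add_expo_le hij.ne (hij.trans hjk).ne hjk.ne h1 hz h2)
  have h00 := aux 0 0 (by decide) (by decide)
  have h10 := aux 1 0 (by decide) (by decide)
  have h11 := aux 1 1 (by decide) (by decide)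
  have h01 := fun hx => y_eq_zero_of_standard hm (hij.trans hjk) hx
  unfold planar at hi hk
  omega

/-! ### Linear independence of the standard monomials on the multiview variety -/

/-- The exponent of the monomial in `λ₁, …, λₙ, a, b` to which the parametrization
`xᵢ ↦ λᵢ a`, `yᵢ ↦ λᵢ b`, `zᵢ ↦ λᵢ (T + eᵢ)` sends a monomial, up to a polynomial in `T`. -/
noncomputable def torusExponent (m : Var n →₀ ℕ) : (Fin n ⊕ Fin 2) →₀ ℕ :=
  Finsupp.equivFunOnFinite.symm (Sum.elim (fun i => planar m i + m (toLex (2, i)))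
    ![∑ i, m (toLex (0, i)), ∑ i, m (toLex (1, i))])

theorem torusExponent_eq {m m' : Var n →₀ ℕ} (h : torusExponent m = torusExponent m') :
    (∀ i, planar m i + m (toLex (2, i)) = planar m' i + m' (toLex (2, i))) ∧
    ∑ i, m (toLex (0, i)) = ∑ i, m' (toLex (0, i)) ∧
    ∑ i, m (toLex (1, i)) = ∑ i, m' (toLex (1, i)) :=
  ⟨fun i => DFunLike.congr_fun h (Sum.inl i), DFunLike.congr_fun h (Sum.inr 0),
    DFunLike.congr_fun h (Sum.inr 1)⟩

theorem sum_planar_eq {m m' : Var n →₀ ℕ} (h : torusExponent m = torusExponent m') :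
    ∑ i, planar m i = ∑ i, planar m' i := by
  simp only [planar, Finset.sum_add_distrib, (torusExponent_eq h).2.1, (torusExponent_eq h).2.2]

/-- In a standard monomial the `y`s stand at cameras not larger than those of the `x`s, so that
their distribution is determined by their number. -/
theorem eq_of_planar_eq {m m' : Var n →₀ ℕ} (hm : m ∈ standardExponents n)
    (hm' : m' ∈ standardExponents n) (h : torusExponent m = torusExponent m')
    (hp : ∀ i, planar m i = planar m' i) : m = m' := by
  obtain ⟨hu, hx, hy⟩ := torusExponent_eq h
  have hx' : ∀ i, m (toLex (0, i)) = m' (toLex (0, i)) := by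
    by_contra! hne
    obtain ⟨i, hi⟩ := hne
    obtain ⟨k, hk⟩ : ∃ k, m (toLex (0, k)) < m' (toLex (0, k)) := by
      by_contra! hle
      exact hx.not_gt (Finset.sum_lt_sum (fun j _ => hle j)
        ⟨i, Finset.mem_univ _, lt_of_le_of_ne (hle i) hi.symm⟩)
    obtain ⟨l, hl⟩ : ∃ l, m' (toLex (0, l)) < m (toLex (0, l)) := by
      by_contra! hle
      exact hx.not_lt (Finset.sum_lt_sum (fun j _ => hle j)
        ⟨i, Finset.mem_univ _, lt_of_le_of_ne (hle i) hi⟩)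
    have pk := hp k
    have pl := hp l
    unfold planar at pk pl
    rcases lt_trichotomy k l with hkl | rfl | hkl
    · have := y_eq_zero_of_standard hm' hkl (by omega)
      omega
    · omega
    · have := y_eq_zero_of_standard hm hkl (by omega)
      omega
  ext v
  obtain ⟨⟨c, i⟩, rfl⟩ := toLex.surjective v
  have h0 := hx' i
  have h1 := hp i
  have h2 := hu i
  unfold planar at h1 h2
  fin_cases c
  · exact h0
  · change m (toLex (1, i)) = m' (toLex (1, i)); omega
  · change m (toLex (2, i)) = m' (toLex (2, i)); omega

/-- Two standard monomials with the same image exponent in the torus cannot have planar degrees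
that first differ, from above, at a camera `l` below a common planar camera: the smaller one would
have a `z` at camera `l`, hence no planar degree below `l`, and a smaller total. -/
theorem not_planar_lt {m m' : Var n →₀ ℕ} (hm : m ∈ standardExponents n)
    (h : torusExponent m = torusExponent m') {l k : Fin n} (hlk : l < k) (hk : 0 < planar m k)
    (habove : ∀ j, l < j → planar m j = planar m' j) : ¬ planar m l < planar m' l := by
  intro hlt
  have hz : 0 < m (toLex (2, l)) := by
    have := (torusExponent_eq h).1 l
    omega
  refine (sum_planar_eq h).not_lt (Finset.sum_lt_sum (fun j _ => ?_) ⟨l, Finset.mem_univ _, hlt⟩)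
  rcases lt_trichotomy j l with hj | rfl | hj
  · by_contra! hpos
    have := z_eq_zero_of_standard hm hj hlk (by omega) hk
    omega
  · exact hlt.le
  · exact (habove j hj).le

/-- A standard monomial is determined by its image exponent in the torus, its largest planar
camera and the planar degree there. -/
theorem eq_of_top_planar_eq {m m' : Var n →₀ ℕ} (hm : m ∈ standardExponents n)
    (hm' : m' ∈ standardExponents n) (h : torusExponent m = torusExponent m') {k : Fin n}
    (hk : 0 < planar m k) (hkk : planar m k = planar m' k)
    (htop : ∀ j, k < j → planar m j = 0) (htop' : ∀ j, k < j → planar m' j = 0) : m = m' := by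
  refine eq_of_planar_eq hm hm' h ?_
  by_contra! hne
  have hne' : (Finset.univ.filter fun i => planar m i ≠ planar m' i).Nonempty := by
    obtain ⟨i, hi⟩ := hne
    exact ⟨i, by simpa using hi⟩
  obtain ⟨l, hl, hmax⟩ := Finset.exists_max_image _ id hne'
  simp only [Finset.mem_filter, Finset.mem_univ, true_and, id] at hl hmax
  have habove : ∀ j, l < j → planar m j = planar m' j := by
    intro j hj
    by_contra h'
    exact absurd (hmax j h') (not_le.mpr hj)
  have hlk : l < k := by
    rcases lt_trichotomy l k with h' | rfl | h'
    · exact h'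
    · exact absurd hkk hl
    · exact absurd ((htop l h').trans (htop' l h').symm) hl
  rcases lt_or_gt_of_ne hl with h' | h'
  · exact not_planar_lt hm h hlk hk habove h'
  · exact not_planar_lt hm' h.symm hlk (hkk ▸ hk) (fun j hj => (habove j hj).symm) h'

/-- The factor in `T` of the image of a monomial under the parametrization. -/
noncomputable def lineFactor {F : Type*} [Field F] (e : Fin n → F) (m : Var n →₀ ℕ) :
    Polynomial F :=
  ∏ i, (Polynomial.X + Polynomial.C (e i)) ^ m (toLex (2, i))

theorem lineFactor_ne_zero {F : Type*} [Field F] (e : Fin n → F) (m : Var n →₀ ℕ) :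
    lineFactor e m ≠ 0 :=
  Finset.prod_ne_zero_iff.mpr fun _ _ => pow_ne_zero _ (Polynomial.X_add_C_ne_zero _)

theorem not_pow_dvd_lineFactor {F : Type*} [Field F] {e : Fin n → F} (he : e.Injective)
    (m : Var n →₀ ℕ) (k : Fin n) :
    ¬ (Polynomial.X + Polynomial.C (e k)) ^ (m (toLex (2, k)) + 1) ∣ lineFactor e m := by
  rw [lineFactor, ← Finset.mul_prod_erase _ _ (Finset.mem_univ k), pow_succ,
    mul_dvd_mul_iff_left (pow_ne_zero _ (Polynomial.X_add_C_ne_zero _))]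
  intro hdvd
  have h0 := Polynomial.eval_dvd (x := -e k) hdvd
  simp only [Polynomial.eval_add, Polynomial.eval_X, Polynomial.eval_C, neg_add_cancel,
    zero_dvd_iff, Polynomial.eval_prod, Polynomial.eval_pow, Finset.prod_eq_zero_iff] at h0
  obtain ⟨i, hi, h0⟩ := h0
  have h1 := eq_zero_of_pow_eq_zero h0
  rw [neg_add_eq_zero] at h1
  exact Finset.ne_of_mem_erase hi (he h1).symm

/-- Triangularity: among the standard monomials with a given image exponent in the torus, the one
with the highest planar degree at the highest possible camera `k` has the smallest power of
`T + eₖ`. -/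
theorem eq_empty_of_sum_lineFactor_eq_zero {F : Type*} [Field F] {e : Fin n → F}
    (he : e.Injective) (S : Finset (Var n →₀ ℕ)) (hS : ∀ m ∈ S, m ∈ standardExponents n)
    (c : (Var n →₀ ℕ) → F) (hc : ∀ m ∈ S, c m ≠ 0)
    (h : ∀ k, ∑ m ∈ S with torusExponent m = k, Polynomial.C (c m) * lineFactor e m = 0) :
    S = ∅ := by
  classical
  by_contra hne
  obtain ⟨m₀, hm₀⟩ := Finset.nonempty_iff_ne_empty.mpr hne
  set T := S.filter fun m => torusExponent m = torusExponent m₀ with hT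
  have hsum := h (torusExponent m₀)
  rw [← hT] at hsum
  have hTS : ∀ m ∈ T, m ∈ S := fun m hm => (Finset.mem_filter.mp hm).1
  have hkey : ∀ m ∈ T, ∀ m' ∈ T, torusExponent m = torusExponent m' := fun m hm m' hm' =>
    (Finset.mem_filter.mp hm).2.trans (Finset.mem_filter.mp hm').2.symm
  have hm₀T : m₀ ∈ T := Finset.mem_filter.mpr ⟨hm₀, rfl⟩
  -- It suffices to find a member of `T` and a camera whose linear factor divides all others more.
  suffices hex : ∃ m ∈ T, ∃ d : Polynomial F, ¬ d ∣ lineFactor e m ∧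
      ∀ m' ∈ T, m' ≠ m → d ∣ lineFactor e m' by
    obtain ⟨m, hm, d, hd, hothers⟩ := hex
    rw [← Finset.add_sum_erase _ _ hm] at hsum
    have hdvd : d ∣ Polynomial.C (c m) * lineFactor e m := by
      rw [eq_neg_of_add_eq_zero_left hsum, dvd_neg]
      exact Finset.dvd_sum fun m' hm' => Dvd.dvd.mul_left
        (hothers m' (Finset.mem_of_mem_erase hm') (Finset.ne_of_mem_erase hm')) _
    exact hd ((Polynomial.isUnit_C.mpr (hc m (hTS m hm)).isUnit).dvd_mul_left.mp hdvd)
  set P : Finset (Fin n) := Finset.univ.filter fun i => ∃ m ∈ T, 0 < planar m i with hP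
  rcases P.eq_empty_or_nonempty with hPe | hPne
  · -- Without planar degrees, `m₀` is the only member.
    have hzero : ∀ m ∈ T, ∀ i, planar m i = 0 := by
      intro m hm i
      by_contra h'
      have : i ∈ P := by simpa [hP] using ⟨m, hm, Nat.pos_of_ne_zero h'⟩
      simp [hPe] at this
    refine ⟨m₀, hm₀T, 0, by simpa using lineFactor_ne_zero e m₀, fun m' hm' hne' => ?_⟩
    exact absurd (eq_of_planar_eq (hS _ (hTS _ hm')) (hS _ hm₀) (hkey _ hm' _ hm₀T)
      fun i => by rw [hzero m' hm', hzero m₀ hm₀T]) hne'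
  · obtain ⟨k, hk, hkmax⟩ := Finset.exists_max_image P id hPne
    have htop : ∀ m ∈ T, ∀ j, k < j → planar m j = 0 := by
      intro m hm j hj
      by_contra h'
      have : j ∈ P := by simpa [hP] using ⟨m, hm, Nat.pos_of_ne_zero h'⟩
      exact absurd (hkmax j this) (not_le.mpr hj)
    obtain ⟨m, hm, hmmax⟩ := Finset.exists_max_image T (fun m => planar m k) ⟨m₀, hm₀T⟩
    obtain ⟨m₁, hm₁, hpos₁⟩ := (Finset.mem_filter.mp hk).2
    have hpos : 0 < planar m k := hpos₁.trans_le (hmmax m₁ hm₁)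
    refine ⟨m, hm, _, not_pow_dvd_lineFactor he m k, fun m' hm' hne' => ?_⟩
    have hlt : planar m' k < planar m k := by
      refine lt_of_le_of_ne (hmmax m' hm') fun heq => hne' ?_
      exact (eq_of_top_planar_eq (hS _ (hTS _ hm)) (hS _ (hTS _ hm')) (hkey _ hm _ hm') hpos
        heq.symm (htop m hm) (htop m' hm')).symm
    have hu := (torusExponent_eq (hkey _ hm _ hm')).1 k
    exact (pow_dvd_pow _ (by omega)).trans (Finset.dvd_prod_of_mem _ (Finset.mem_univ k))

end Exponents

/-! ### The multiview ideal of the collinear cameras -/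

section CollinearCameras

/-- A set of points and its Zariski closure have the same vanishing ideal. -/
theorem mem_multiviewIdeal {F : Type*} [Field F] {n : ℕ} {A : Fin n → Matrix (Fin 3) (Fin 4) F}
    {f : MvPolynomial (Var n) F} : f ∈ multiviewIdeal A ↔
      ∀ P ∈ cameraImage (fun i => (A i).map (algebraMap F (AlgebraicClosure F))),
        VanishesAt (map (algebraMap F (AlgebraicClosure F)) f) P :=
  ⟨fun h P hP => h P fun _ hg => hg P hP, fun h _ hP => hP _ h⟩

variable {K : Type*} [Field K] {n : ℕ}

theorem epsPow_injective : Function.Injective (epsPow K : Fin n → RatFunc K) := by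
  intro i j h
  have h' : (algebraMap (Polynomial K) (RatFunc K)) (Polynomial.X ^ (n - (i.val + 1)))
      = (algebraMap (Polynomial K) (RatFunc K)) (Polynomial.X ^ (n - (j.val + 1))) := by
    simpa [epsPow] using h
  have h2 := congrArg Polynomial.natDegree (RatFunc.algebraMap_injective K h')
  simp only [Polynomial.natDegree_X_pow] at h2
  ext
  omega

theorem collinearCameras_map_mulVec (i : Fin n) (q : Fin 4 → AlgebraicClosure (RatFunc K)) :
    ((collinearCameras K n i).map (algebraMap (RatFunc K) (AlgebraicClosure (RatFunc K)))).mulVec q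
      = ![q 0 + q 1, q 0 + q 2, algebraMap _ _ (epsPow K i) * q 0 + q 3] := by
  ext c
  fin_cases c <;> simp [collinearCameras, Matrix.mulVec, dotProduct, Fin.sum_univ_four]

theorem quadricsAndCubics_subset :
    quadricsAndCubics K n ⊆ multiviewIdeal (collinearCameras K n) := by
  intro f hf
  rw [SetLike.mem_coe, mem_multiviewIdeal]
  rintro P ⟨q, -, hq, hP⟩ p hp hpP
  have hpt : ∀ i, ∃ r : AlgebraicClosure (RatFunc K), p i 0 = r * (q 0 + q 1) ∧
      p i 1 = r * (q 0 + q 2) ∧ p i 2 = r * (algebraMap _ _ (epsPow K i) * q 0 + q 3) := by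
    intro i
    obtain ⟨r, hr⟩ := (Projectivization.mk_eq_mk_iff' _ _ _ _ _).mp ((hpP i).trans (hP i))
    rw [collinearCameras_map_mulVec] at hr
    exact ⟨r, by simp [← hr], by simp [← hr], by simp [← hr]⟩
  choose r h0 h1 h2 using hpt
  rcases hf with ⟨i, j, -, rfl⟩ | ⟨i, j, k, -, -, rfl | rfl | rfl⟩
  · simp only [x, y, map_sub, map_mul, map_X, eval_X, ofLex_toLex, h0, h1]
    ring
  all_goals
    simp only [threeTerm, x, y, z, map_add, map_sub, map_mul, map_X, map_C, eval_X, eval_C,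
      ofLex_toLex, h0, h1, h2]
    ring

/-- The value of a monomial at a point of the parametrized multiview variety. -/
theorem prod_parametrization {Ω : Type*} [Field Ω] (e : Fin n → Ω) (s : Fin n ⊕ Fin 2 → Ω) (t : Ω)
    (m : Var n →₀ ℕ) :
    ∏ v, (s (Sum.inl (ofLex v).2) * ![s (Sum.inr 0), s (Sum.inr 1), t + e (ofLex v).2] (ofLex v).1)
        ^ m v
      = (lineFactor e m).eval t * ∏ k, s k ^ torusExponent m k := by
  rw [← toLex.prod_comp, Fintype.prod_prod_type, Fintype.prod_sum_type]
  simp only [Fin.prod_univ_three, ofLex_toLex, lineFactor, Polynomial.eval_prod, mul_pow,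
    Finset.prod_mul_distrib, Fin.prod_univ_two, torusExponent, planar,
    Finsupp.equivFunOnFinite_symm_apply_apply, Sum.elim_inl, Sum.elim_inr, pow_add]
  simp [Finset.prod_pow_eq_pow_sum]
  ring

/-- The polynomials of the multiview ideal vanish on its parametrization, in the coordinates
`q = (1, a - 1, b - 1, T)` of `ℙ³`; the statement collects the coefficients at a given monomial in
`λ₁, …, λₙ, a, b`. -/
theorem sum_lineFactor_eq_zero {f : MvPolynomial (Var n) (RatFunc K)}
    (hf : f ∈ multiviewIdeal (collinearCameras K n)) (k : Fin n ⊕ Fin 2 →₀ ℕ) :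
    ∑ m ∈ f.support with torusExponent m = k,
      Polynomial.C (algebraMap (RatFunc K) (AlgebraicClosure (RatFunc K)) (coeff m f)) *
        lineFactor (fun i => algebraMap (RatFunc K) (AlgebraicClosure (RatFunc K)) (epsPow K i)) m
      = 0 := by
  classical
  rw [mem_multiviewIdeal] at hf
  set ι := algebraMap (RatFunc K) (AlgebraicClosure (RatFunc K)) with hι
  set e : Fin n → AlgebraicClosure (RatFunc K) := fun i => ι (epsPow K i) with he
  refine Polynomial.funext fun t => ?_
  set Ψ : MvPolynomial (Fin n ⊕ Fin 2) (AlgebraicClosure (RatFunc K)) :=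
    ∑ m ∈ f.support, monomial (torusExponent m) (ι (coeff m f) * (lineFactor e m).eval t) with hΨ
  -- The factor excludes the parameters at which the projective points are not defined.
  have hΨ0 : Ψ * ∏ v, X v = 0 := by
    refine MvPolynomial.funext fun s => ?_
    rw [map_mul, map_zero, map_prod]
    simp only [eval_X]
    by_cases hs : ∃ v, s v = 0
    · obtain ⟨v, hv⟩ := hs
      rw [Finset.prod_eq_zero (Finset.mem_univ v) hv, mul_zero]
    push Not at hs
    refine mul_eq_zero_of_left ?_ _
    set q : Fin 4 → AlgebraicClosure (RatFunc K) :=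
      ![1, s (Sum.inr 0) - 1, s (Sum.inr 1) - 1, t] with hq
    set w : Fin n → Fin 3 → AlgebraicClosure (RatFunc K) :=
      fun i => ![s (Sum.inr 0), s (Sum.inr 1), t + e i] with hw
    have hAq : ∀ i, ((collinearCameras K n i).map ι).mulVec q = w i := by
      intro i
      rw [collinearCameras_map_mulVec]
      simp [hq, hw, he, ← hι, add_comm]
    have hw0 : ∀ i, w i ≠ 0 := fun i h => hs (Sum.inr 0) (by simpa [hw] using congrFun h 0)
    have hq0 : q ≠ 0 := fun h =>
      one_ne_zero (α := AlgebraicClosure (RatFunc K)) (by simpa [hq] using congrFun h 0)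
    have hsw : ∀ i, s (Sum.inl i) • w i ≠ 0 := fun i => smul_ne_zero (hs _) (hw0 i)
    have hval := hf (fun i => Projectivization.mk _ (w i) (hw0 i))
      ⟨q, hq0, fun i => by rw [hAq]; exact hw0 i, fun i => by simp only [hAq]⟩
      (fun i => s (Sum.inl i) • w i) hsw
      fun i => (Projectivization.mk_eq_mk_iff' _ _ _ _ _).mpr ⟨_, rfl⟩
    rw [eval_map, eval₂_eq'] at hval
    rw [hΨ, map_sum, ← hval]
    refine Finset.sum_congr rfl fun m _ => ?_
    rw [eval_monomial, mul_assoc, Finsupp.prod_fintype _ _ fun _ => pow_zero _,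
      ← prod_parametrization]
    rfl
  have hΨ1 : Ψ = 0 := (mul_eq_zero.mp hΨ0).resolve_right
    (Finset.prod_ne_zero_iff.mpr fun v _ => X_ne_zero v)
  have hcoeff := congrArg (coeff k) hΨ1
  rw [hΨ, coeff_sum] at hcoeff
  simp only [coeff_monomial, coeff_zero] at hcoeff
  rw [Polynomial.eval_finsetSum, Finset.sum_filter, Polynomial.eval_zero]
  refine (Finset.sum_congr rfl fun m _ => ?_).trans hcoeff
  split_ifs <;> simp

/-- The standard monomials are linearly independent modulo the multiview ideal. -/
theorem eq_zero_of_mem_multiviewIdeal {f : MvPolynomial (Var n) (RatFunc K)}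
    (hf : f ∈ multiviewIdeal (collinearCameras K n))
    (hstd : f ∈ restrictSupport (RatFunc K) (standardExponents n)) : f = 0 := by
  rw [← support_eq_empty]
  refine eq_empty_of_sum_lineFactor_eq_zero (F := AlgebraicClosure (RatFunc K))
    ((algebraMap (RatFunc K) (AlgebraicClosure (RatFunc K))).injective.comp epsPow_injective)
    f.support (fun m hm => hstd hm) (fun m => algebraMap _ _ (coeff m f)) (fun m hm => ?_)
    (sum_lineFactor_eq_zero hf)
  simpa using hm

end CollinearCameras

/-! ### Standard monomials as a complement of an ideal -/

section Complement

variable {R : Type*} [CommRing R] {n : ℕ}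

/-- If the exchanges hold modulo an ideal up to multiples of a small ideal `𝔪` in the same degree,
then the standard monomials span the quotient: rewriting lowers the weight, and Nakayama's lemma in
each degree removes the error terms. -/
theorem restrictSupport_sup_eq_top {𝔪 : Ideal R} (h𝔪 : 𝔪 ≤ Ideal.jacobson ⊥)
    {I : Ideal (MvPolynomial (Var n) R)}
    (hI : ∀ a b, Exchange a b → ∃ c : R, ∃ δ ∈ 𝔪, ∃ h : MvPolynomial (Var n) R,
      h.IsHomogeneous a.degree ∧ monomial a 1 - monomial b c + C δ * h ∈ I) :
    restrictSupport R (standardExponents n) ⊔ I.restrictScalars R = ⊤ := by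
  set W := restrictSupport R (standardExponents n) ⊔ I.restrictScalars R with hW
  have hWI : ∀ f ∈ I, f ∈ W := fun f hf => Submodule.mem_sup_right hf
  have hhom : ∀ d : ℕ, ∀ f : MvPolynomial (Var n) R, f.IsHomogeneous d →
      f ∈ Submodule.span R ((fun m => monomial m (1 : R)) '' {m : Var n →₀ ℕ | m.degree = d}) := by
    intro d f hf
    rw [← support_sum_monomial_coeff f]
    refine Submodule.sum_mem _ fun m hm => ?_
    rw [← mul_one (coeff m f), ← smul_eq_mul, ← smul_monomial]
    refine Submodule.smul_mem _ _ (Submodule.subset_span ⟨m, ?_, rfl⟩)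
    rw [Set.mem_ofPred_eq, Finsupp.degree_eq_weight_one]
    exact hf (mem_support_iff.mp hm)
  have key : ∀ d : ℕ,
      Submodule.span R ((fun m => monomial m (1 : R)) '' {m : Var n →₀ ℕ | m.degree = d}) ≤ W := by
    intro d
    set M := Submodule.span R
      ((fun m => monomial m (1 : R)) '' {m : Var n →₀ ℕ | m.degree = d}) with hM
    have hfg : M.FG := Submodule.fg_span (Set.Finite.image _
      (Finsupp.finite_of_degree_eq d))
    refine Submodule.le_of_le_smul_of_le_jacobson_bot hfg h𝔪 (Submodule.span_le.mpr ?_)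
    rintro _ ⟨m, hm, rfl⟩
    simp only [Set.mem_ofPred_eq] at hm
    induction hw : weight m using Nat.strong_induction_on generalizing m with
    | _ N ih =>
      by_cases hstd : m ∈ standardExponents n
      · exact Submodule.mem_sup_left (Submodule.mem_sup_left
          ((monomial_mem_restrictSupport R).mpr (Or.inl hstd)))
      · simp only [standardExponents, Set.mem_ofPred_eq, not_forall, not_not] at hstd
        obtain ⟨a, b, hab, ham⟩ := hstd
        obtain ⟨r, rfl⟩ := exists_add_of_le ham
        obtain ⟨c, δ, hδ, h, hh, hmem⟩ := hI a b hab
        have hsplit : (monomial (a + r) (1 : R)) = monomial r 1 * (monomial a 1 - monomial b c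
            + C δ * h) + c • monomial (b + r) 1 - δ • (monomial r 1 * h) := by
          rw [mul_add, mul_sub, monomial_mul, monomial_mul, smul_monomial, smul_eq_C_mul,
            add_comm r a, add_comm r b]
          simp only [one_mul, smul_eq_mul, mul_one]
          ring
        change monomial (a + r) (1 : R) ∈ _
        rw [hsplit]
        refine Submodule.sub_mem _ (Submodule.add_mem _ (Submodule.mem_sup_left
          (hWI _ (Ideal.mul_mem_left _ _ hmem))) (Submodule.smul_mem _ _ ?_))
          (Submodule.mem_sup_right (Submodule.smul_mem_smul hδ ?_))
        · refine ih (weight (b + r)) ?_ _ ?_ rfl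
          · rw [← hw, weight_add, weight_add]
            exact Nat.add_lt_add_right hab.weight_lt _
          · rw [← hm, map_add, map_add, hab.degree_eq]
        · refine hhom d _ ?_
          rw [← hm, map_add, add_comm]
          exact (isHomogeneous_monomial _ rfl).mul hh
  rw [eq_top_iff]
  intro f _
  rw [← sum_homogeneousComponent f]
  exact Submodule.sum_mem _ fun d _ => key d (hhom d _ (homogeneousComponent_isHomogeneous d f))

/-- A quotient with the standard monomials as a basis is flat. -/
theorem flat_quotient_of_isCompl {I : Ideal (MvPolynomial (Var n) R)}
    (h : IsCompl (restrictSupport R (standardExponents n)) (I.restrictScalars R)) :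
    Module.Flat R (MvPolynomial (Var n) R ⧸ I) := by
  have : Module.Free R (restrictSupport R (standardExponents n)) :=
    Module.Free.of_basis (basisRestrictSupport R _)
  exact Module.Flat.of_linearEquiv ((Submodule.Quotient.restrictScalarsEquiv R I).symm.trans
    (Submodule.quotientEquivOfIsCompl _ _ h.symm))

end Complement

/-! ### Generators in terms of exchanges -/

section Generators

variable (K : Type*) [Field K] (n : ℕ)

theorem binomialIdeal_eq_span : binomialIdeal K n =
    Ideal.span {f | ∃ a b, Exchange a b ∧ f = monomial a 1 - monomial b 1} := by
  rw [binomialIdeal, Submodule.add_eq_sup, ← Ideal.span_union]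
  congr 1
  ext f
  constructor
  · rintro (⟨i, j, hij, rfl⟩ | ⟨i, j, k, hij, hjk, rfl | rfl | rfl⟩)
    · exact ⟨_, _, .quadric hij, by simp [x, y, X, monomial_mul, expo]⟩
    · exact ⟨_, _, .cubic (p := 0) (q := 0) (by decide) (by decide) hij hjk,
        by simp [x, z, X, monomial_mul, expo]⟩
    · exact ⟨_, _, .cubic (p := 1) (q := 1) (by decide) (by decide) hij hjk,
        by simp [y, z, X, monomial_mul, expo]⟩
    · exact ⟨_, _, .cubic (p := 1) (q := 0) (by decide) (by decide) hij hjk,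
        by simp [x, y, z, X, monomial_mul, expo]⟩
  · rintro ⟨a, b, hab, rfl⟩
    cases hab with
    | @quadric i j hij => exact Or.inl ⟨i, j, hij, by simp [x, y, X, monomial_mul, expo]⟩
    | @cubic p q hqp hp i j k hij hjk =>
      refine Or.inr ⟨i, j, k, hij, hjk, ?_⟩
      fin_cases p <;> fin_cases q <;> simp at hqp hp
      · exact Or.inl (by simp [x, z, X, monomial_mul, expo])
      · exact Or.inr (Or.inr (by simp [x, y, z, X, monomial_mul, expo]))
      · exact Or.inr (Or.inl (by simp [y, z, X, monomial_mul, expo]))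

theorem monomialIdeal_eq_span : monomialIdeal K n =
    Ideal.span {f | ∃ a b, Exchange a b ∧ f = monomial a 1} := by
  rw [monomialIdeal, Submodule.add_eq_sup, ← Ideal.span_union]
  congr 1
  ext f
  constructor
  · rintro (⟨i, j, hij, rfl⟩ | ⟨i, j, k, hij, hjk, rfl | rfl | rfl⟩)
    · exact ⟨_, _, .quadric hij, by simp [x, y, X, monomial_mul, expo]⟩
    · exact ⟨_, _, .cubic (p := 0) (q := 0) (by decide) (by decide) hij hjk,
        by simp [x, z, X, monomial_mul, expo]⟩
    · exact ⟨_, _, .cubic (p := 1) (q := 1) (by decide) (by decide) hij hjk,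
        by simp [y, z, X, monomial_mul, expo]⟩
    · exact ⟨_, _, .cubic (p := 1) (q := 0) (by decide) (by decide) hij hjk,
        by simp [x, y, z, X, monomial_mul, expo]⟩
  · rintro ⟨a, b, hab, rfl⟩
    cases hab with
    | @quadric i j hij => exact Or.inl ⟨i, j, hij, by simp [x, y, X, monomial_mul, expo]⟩
    | @cubic p q hqp hp i j k hij hjk =>
      refine Or.inr ⟨i, j, k, hij, hjk, ?_⟩
      fin_cases p <;> fin_cases q <;> simp at hqp hp
      · exact Or.inl (by simp [x, z, X, monomial_mul, expo])
      · exact Or.inr (Or.inr (by simp [x, y, z, X, monomial_mul, expo]))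
      · exact Or.inr (Or.inl (by simp [y, z, X, monomial_mul, expo]))

variable {K n}

theorem exchange_mem_binomialIdeal {a b : Var n →₀ ℕ} (h : Exchange a b) :
    monomial a 1 - monomial b 1 ∈ binomialIdeal K n := by
  rw [binomialIdeal_eq_span]
  exact Ideal.subset_span ⟨a, b, h, rfl⟩

theorem monomial_mem_monomialIdeal {m : Var n →₀ ℕ} (hm : m ∉ standardExponents n) (c : K) :
    monomial m c ∈ monomialIdeal K n := by
  simp only [standardExponents, Set.mem_ofPred_eq, not_forall, not_not] at hm
  obtain ⟨a, b, hab, ham⟩ := hm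
  obtain ⟨r, rfl⟩ := exists_add_of_le ham
  have hsplit : monomial (a + r) c = monomial r c * monomial a 1 := by
    rw [monomial_mul, mul_one, add_comm]
  rw [hsplit, monomialIdeal_eq_span]
  exact Ideal.mul_mem_left _ _ (Ideal.subset_span ⟨a, b, hab, rfl⟩)

end Generators

/-! ### The multiview ideal over the valuation ring -/

section ValuationRing

variable (K : Type*) [Field K] {n : ℕ}

/-- The parameter `ε` as an element of the valuation ring. -/
noncomputable def eps : valRing K :=
  ⟨RatFunc.X, by
    rw [← RatFunc.algebraMap_X]
    exact IsDedekindDomain.HeightOneSpectrum.valuation_le_one _ _⟩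

@[simp] theorem coe_eps : (eps K : RatFunc K) = RatFunc.X := rfl

@[simp] theorem evalZero_eps : evalZero K (eps K) = 0 := by
  change RatFunc.eval (RingHom.id K) 0 RatFunc.X = 0
  simp

/-- The constants as elements of the valuation ring. -/
noncomputable def constHom : K →+* valRing K :=
  RingHom.codRestrict (RatFunc.C : K →+* RatFunc K) (valRing K).toSubring fun c => by
    rw [← RatFunc.algebraMap_C]
    exact IsDedekindDomain.HeightOneSpectrum.valuation_le_one _ _

@[simp] theorem evalZero_constHom (c : K) : evalZero K (constHom K c) = c := by
  change RatFunc.eval (RingHom.id K) 0 (RatFunc.C c) = c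
  simp

theorem map_evalZero_constHom (f : MvPolynomial (Var n) K) :
    map (evalZero K) (map (constHom K) f) = f := by
  have h : (evalZero K).comp (constHom K) = RingHom.id K := RingHom.ext (evalZero_constHom K)
  rw [map_map, h]
  exact map_id f

theorem eps_mem_maximalIdeal : eps K ∈ IsLocalRing.maximalIdeal (valRing K) := by
  rw [IsLocalRing.mem_maximalIdeal, mem_nonunits_iff]
  intro h
  simpa using h.map (evalZero K)

variable {K}

/-- The trinomial cubic divided by the power `ε ^ (n - k)`, for the choice of letters in
`Exchange.cubic`; its value at `ε = 0` is a binomial generator of `Lₙ`. -/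
noncomputable def integralCubic (p q : Fin 3) (i j k : Fin n) :
    MvPolynomial (Var n) (valRing K) :=
  C (1 - eps K ^ (k - i : ℕ)) * monomial (expo p i + expo 2 j + expo q k) 1
    + C (eps K ^ (k - j : ℕ) - 1) * monomial (expo 2 i + expo p j + expo q k) 1
    + C (eps K ^ (k - i : ℕ) - eps K ^ (k - j : ℕ)) * monomial (expo p i + expo q j + expo 2 k) 1

variable (K n) in
/-- The ideal over the valuation ring generated by the quadrics and the rescaled cubics. -/
noncomputable def integralIdeal : Ideal (MvPolynomial (Var n) (valRing K)) :=
  Ideal.span ({f | ∃ i j : Fin n, i < j ∧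
      f = monomial (expo 0 i + expo 1 j) 1 - monomial (expo 0 j + expo 1 i) 1} ∪
    {f | ∃ (p q : Fin 3) (i j k : Fin n), q ≤ p ∧ p < 2 ∧ i < j ∧ j < k ∧
      f = integralCubic p q i j k})

theorem map_evalZero_integralCubic (p q : Fin 3) {i j k : Fin n} (hij : i < j) (hjk : j < k) :
    map (evalZero K) (integralCubic p q i j k) =
      monomial (expo p i + expo 2 j + expo q k) 1 - monomial (expo 2 i + expo p j + expo q k) 1 := by
  have h1 : ((k : ℕ) - i) ≠ 0 := by have : (i : ℕ) < k := hij.trans hjk; omega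
  have h2 : ((k : ℕ) - j) ≠ 0 := by have : (j : ℕ) < k := hjk; omega
  simp [integralCubic, h1, h2, sub_eq_add_neg]

/-- At `ε = 0` the integral ideal becomes `Lₙ`. -/
theorem map_evalZero_integralIdeal :
    (integralIdeal K n).map (map (evalZero K)) = binomialIdeal K n := by
  rw [binomialIdeal_eq_span, integralIdeal, Ideal.map_span]
  congr 1
  ext f
  constructor
  · rintro ⟨_, ⟨i, j, hij, rfl⟩ | ⟨p, q, i, j, k, hqp, hp, hij, hjk, rfl⟩, rfl⟩
    · exact ⟨_, _, .quadric hij, by simp⟩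
    · exact ⟨_, _, .cubic hqp hp hij hjk, map_evalZero_integralCubic p q hij hjk⟩
  · rintro ⟨a, b, hab, rfl⟩
    cases hab with
    | @quadric i j hij => exact ⟨_, Or.inl ⟨i, j, hij, rfl⟩, by simp⟩
    | @cubic p q hqp hp i j k hij hjk =>
      exact ⟨_, Or.inr ⟨p, q, i, j, k, hqp, hp, hij, hjk, rfl⟩,
        map_evalZero_integralCubic p q hij hjk⟩

theorem map_subtype_integralCubic (p q : Fin 3) {i j k : Fin n} (hij : i < j) (hjk : j < k) :
    C (epsPow K k) * map (valRing K).subtype (integralCubic p q i j k) =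
      threeTerm K i j k (monomial (expo p i + expo 2 j + expo q k) 1)
        (monomial (expo 2 i + expo p j + expo q k) 1)
        (monomial (expo p i + expo q j + expo 2 k) 1) := by
  have h1 : epsPow K k * RatFunc.X ^ ((k : ℕ) - i) = epsPow K i := by
    have : (i : ℕ) < k := hij.trans hjk
    have := k.2
    rw [epsPow, ← pow_add, epsPow]
    congr 1
    omega
  have h2 : epsPow K k * RatFunc.X ^ ((k : ℕ) - j) = epsPow K j := by
    have : (j : ℕ) < k := hjk
    have := k.2
    rw [epsPow, ← pow_add, epsPow]
    congr 1
    omega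
  simp only [integralCubic, threeTerm, map_add, map_mul, map_C, map_monomial, ← h1, ← h2]
  simp
  ring

/-- Over the field of fractions the integral ideal is generated by `𝒢ₙ`. -/
theorem map_subtype_integralIdeal :
    (integralIdeal K n).map (map (valRing K).subtype) = Ideal.span (quadricsAndCubics K n) := by
  have hcubic : ∀ (p q : Fin 3) (i j k : Fin n), q ≤ p → p < 2 → i < j → j < k →
      threeTerm K i j k (monomial (expo p i + expo 2 j + expo q k) 1)
        (monomial (expo 2 i + expo p j + expo q k) 1)
        (monomial (expo p i + expo q j + expo 2 k) 1) ∈ quadricsAndCubics K n := by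
    intro p q i j k hqp hp hij hjk
    refine Or.inr ⟨i, j, k, hij, hjk, ?_⟩
    fin_cases p <;> fin_cases q <;> simp at hqp hp
    · exact Or.inl (by simp [x, z, X, monomial_mul, expo])
    · exact Or.inr (Or.inr (by simp [x, y, z, X, monomial_mul, expo]))
    · exact Or.inr (Or.inl (by simp [y, z, X, monomial_mul, expo]))
  have hmem : ∀ (p q : Fin 3) (i j k : Fin n), q ≤ p → p < 2 → i < j → j < k →
      threeTerm K i j k (monomial (expo p i + expo 2 j + expo q k) 1)
        (monomial (expo 2 i + expo p j + expo q k) 1)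
        (monomial (expo p i + expo q j + expo 2 k) 1) ∈
        (integralIdeal K n).map (map (valRing K).subtype) := by
    intro p q i j k hqp hp hij hjk
    rw [← map_subtype_integralCubic p q hij hjk]
    exact Ideal.mul_mem_left _ _ (Ideal.mem_map_of_mem _
      (Ideal.subset_span (Or.inr ⟨p, q, i, j, k, hqp, hp, hij, hjk, rfl⟩)))
  apply le_antisymm
  · rw [integralIdeal, Ideal.map_span, Ideal.span_le]
    rintro _ ⟨_, ⟨i, j, hij, rfl⟩ | ⟨p, q, i, j, k, hqp, hp, hij, hjk, rfl⟩, rfl⟩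
    · exact Ideal.subset_span (Or.inl ⟨i, j, hij, by simp [x, y, X, monomial_mul, expo]⟩)
    · -- The power of `ε` that was divided out is invertible in `K(ε)`.
      have hunit : IsUnit (C (σ := Var n) (epsPow K k)) :=
        (IsUnit.mk0 _ (pow_ne_zero _ RatFunc.X_ne_zero)).map C
      rw [SetLike.mem_coe, ← Ideal.unit_mul_mem_iff_mem _ hunit, map_subtype_integralCubic p q hij hjk]
      exact Ideal.subset_span (hcubic p q i j k hqp hp hij hjk)
  · rw [Ideal.span_le]
    rintro _ (⟨i, j, hij, rfl⟩ | ⟨i, j, k, hij, hjk, rfl | rfl | rfl⟩)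
    · have hgen : x i * y j - x j * y i = map (valRing K).subtype
          (monomial (expo 0 i + expo 1 j) 1 - monomial (expo 0 j + expo 1 i) 1) := by
        simp [x, y, X, monomial_mul, expo]
      rw [hgen]
      exact Ideal.mem_map_of_mem _ (Ideal.subset_span (Or.inl ⟨i, j, hij, rfl⟩))
    · have := hmem 0 0 i j k (by decide) (by decide) hij hjk
      simpa [x, z, X, monomial_mul, expo] using this
    · have := hmem 1 1 i j k (by decide) (by decide) hij hjk
      simpa [y, z, X, monomial_mul, expo] using this
    · have := hmem 1 0 i j k (by decide) (by decide) hij hjk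
      simpa [x, y, z, X, monomial_mul, expo] using this

/-- The standard monomials span modulo the integral ideal: by the expansion of the coefficients of
the rescaled cubics in `ε`, the exchanges hold modulo `ε`. -/
theorem restrictSupport_sup_integralIdeal :
    restrictSupport (valRing K) (standardExponents n) ⊔
      (integralIdeal K n).restrictScalars (valRing K) = ⊤ := by
  refine restrictSupport_sup_eq_top (IsLocalRing.maximalIdeal_le_jacobson _) fun a b hab => ?_
  cases hab with
  | @quadric i j hij =>
    refine ⟨1, 0, Ideal.zero_mem _, 0, isHomogeneous_zero _ _ _, ?_⟩
    rw [mul_zero, add_zero]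
    exact Ideal.subset_span (Or.inl ⟨i, j, hij, rfl⟩)
  | @cubic p q hqp hp i j k hij hjk =>
    have h1 : (k : ℕ) - i = (k - i - 1) + 1 := by
      have : (i : ℕ) < k := hij.trans hjk
      omega
    have h2 : (k : ℕ) - j = (k - j - 1) + 1 := by
      have : (j : ℕ) < k := hjk
      omega
    have hmem : integralCubic p q i j k ∈ integralIdeal K n :=
      Ideal.subset_span (Or.inr ⟨p, q, i, j, k, hqp, hp, hij, hjk, rfl⟩)
    refine ⟨1, eps K, eps_mem_maximalIdeal K,
      C (-eps K ^ (k - i - 1 : ℕ)) * monomial (expo p i + expo 2 j + expo q k) 1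
      + C (eps K ^ (k - j - 1 : ℕ)) * monomial (expo 2 i + expo p j + expo q k) 1
      + C (eps K ^ (k - i - 1 : ℕ) - eps K ^ (k - j - 1 : ℕ)) *
          monomial (expo p i + expo q j + expo 2 k) 1, ?_, ?_⟩
    · simp only [C_mul_monomial]
      exact ((isHomogeneous_monomial _ rfl).add (isHomogeneous_monomial _ (by simp [expo]))).add
        (isHomogeneous_monomial _ (by simp [expo]))
    · convert hmem using 1
      rw [integralCubic, h1, h2]
      simp only [map_sub, map_neg, map_one, map_pow]
      simp only [Nat.add_sub_cancel]
      ring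

theorem integralIdeal_le : integralIdeal K n ≤
    integralPart (multiviewIdeal (collinearCameras K n)) := by
  rw [integralPart, ← Ideal.map_le_iff_le_comap, map_subtype_integralIdeal, Ideal.span_le]
  exact quadricsAndCubics_subset

theorem map_subtype_injective :
    Function.Injective (map (σ := Var n) (valRing K).subtype) :=
  map_injective _ Subtype.val_injective

/-- The standard monomials are linearly independent modulo the integral part. -/
theorem eq_zero_of_mem_integralPart {f : MvPolynomial (Var n) (valRing K)}
    (hf : f ∈ integralPart (multiviewIdeal (collinearCameras K n)))
    (hstd : f ∈ restrictSupport (valRing K) (standardExponents n)) : f = 0 := by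
  refine map_subtype_injective ?_
  rw [map_zero]
  exact eq_zero_of_mem_multiviewIdeal hf fun m hm => hstd (support_map_subset _ _ hm)

/-- The polynomials of the multiview ideal over the valuation ring are generated by the quadrics
and the rescaled cubics. -/
theorem integralPart_eq :
    integralPart (multiviewIdeal (collinearCameras K n)) = integralIdeal K n := by
  refine le_antisymm (fun f hf => ?_) integralIdeal_le
  obtain ⟨s, hs, g, hg, rfl⟩ := Submodule.mem_sup.mp
    (restrictSupport_sup_integralIdeal.ge (Submodule.mem_top (x := f)))
  have hg' : g ∈ integralIdeal K n := hg
  have hs' := (Ideal.add_mem_iff_left _ (integralIdeal_le hg')).mp hf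
  rw [eq_zero_of_mem_integralPart hs' hs, zero_add]
  exact hg'

/-- The multiview ideal is generated by `𝒢ₙ`. -/
theorem multiviewIdeal_eq_span : multiviewIdeal (collinearCameras K n) =
    Ideal.span (quadricsAndCubics K n) := by
  refine le_antisymm (fun f hf => ?_) (Ideal.span_le.mpr quadricsAndCubics_subset)
  have hle : Ideal.span (quadricsAndCubics K n) ≤ multiviewIdeal (collinearCameras K n) :=
    Ideal.span_le.mpr quadricsAndCubics_subset
  have hspan : ∀ f : MvPolynomial (Var n) (RatFunc K),
      f ∈ restrictSupport (RatFunc K) (standardExponents n) ⊔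
        (Ideal.span (quadricsAndCubics K n)).restrictScalars (RatFunc K) := by
    intro f
    induction f using MvPolynomial.induction_on' with
    | monomial m c =>
      obtain ⟨s, hs, g, hg, hsg⟩ := Submodule.mem_sup.mp (restrictSupport_sup_integralIdeal.ge
        (Submodule.mem_top (x := (monomial m 1 : MvPolynomial (Var n) (valRing K)))))
      have h1 := congrArg (map (valRing K).subtype) hsg
      rw [map_add, map_monomial, map_one] at h1
      rw [← mul_one c, ← smul_eq_mul, ← smul_monomial, ← h1]
      refine Submodule.smul_mem _ _ (Submodule.add_mem_sup
        (fun m hm => hs (support_map_subset _ _ hm)) ?_)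
      rw [Submodule.restrictScalars_mem, ← map_subtype_integralIdeal]
      exact Ideal.mem_map_of_mem _ hg
    | add p q hp hq => exact Submodule.add_mem _ hp hq
  obtain ⟨s, hs, g, hg, rfl⟩ := Submodule.mem_sup.mp (hspan f)
  have hs' := (Ideal.add_mem_iff_left _ (hle hg)).mp hf
  rw [eq_zero_of_mem_multiviewIdeal hs' hs, zero_add]
  exact hg

theorem specialFiber_eq :
    specialFiber (multiviewIdeal (collinearCameras K n)) = binomialIdeal K n := by
  rw [specialFiber, integralPart_eq, map_evalZero_integralIdeal]

theorem flat_integralPart : Module.Flat (valRing K) (MvPolynomial (Var n) (valRing K) ⧸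
    integralPart (multiviewIdeal (collinearCameras K n))) := by
  refine flat_quotient_of_isCompl ⟨Submodule.disjoint_def.mpr fun f hstd hf =>
    eq_zero_of_mem_integralPart hf hstd, codisjoint_iff.mpr ?_⟩
  rw [integralPart_eq]
  exact restrictSupport_sup_integralIdeal

theorem map_integralPart : (integralPart (multiviewIdeal (collinearCameras K n))).map
    (map (valRing K).subtype) = multiviewIdeal (collinearCameras K n) := by
  rw [integralPart_eq, map_subtype_integralIdeal, multiviewIdeal_eq_span]

/-- The standard monomials are linearly independent modulo `Lₙ`: a relation lifts to the valuation
ring up to an error that vanishes at `ε = 0`, and the standard form of the error does so too. -/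
theorem eq_zero_of_mem_binomialIdeal {f : MvPolynomial (Var n) K} (hf : f ∈ binomialIdeal K n)
    (hstd : f ∈ restrictSupport K (standardExponents n)) : f = 0 := by
  -- The map from monomials to standard representatives is linear, so it keeps coefficients in the
  -- kernel of the evaluation at `ε = 0`.
  have herr : ∀ k : MvPolynomial (Var n) (valRing K), map (evalZero K) k = 0 →
      ∃ s ∈ restrictSupport (valRing K) (standardExponents n),
        map (evalZero K) s = 0 ∧ k - s ∈ integralIdeal K n := by
    intro k hk
    have hmon : ∀ m : Var n →₀ ℕ, ∃ s ∈ restrictSupport (valRing K) (standardExponents n),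
        monomial m 1 - s ∈ integralIdeal K n := by
      intro m
      obtain ⟨s, hs, g, hg, hsg⟩ := Submodule.mem_sup.mp (restrictSupport_sup_integralIdeal.ge
        (Submodule.mem_top (x := (monomial m 1 : MvPolynomial (Var n) (valRing K)))))
      exact ⟨s, hs, by rw [← hsg, add_sub_cancel_left]; exact hg⟩
    choose s hs hsI using hmon
    refine ⟨∑ m ∈ k.support, coeff m k • s m,
      Submodule.sum_mem _ fun m _ => Submodule.smul_mem _ _ (hs m), ?_, ?_⟩
    · rw [map_sum]
      refine Finset.sum_eq_zero fun m _ => ?_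
      have := congrArg (coeff m) hk
      rw [coeff_map, coeff_zero] at this
      rw [smul_eq_C_mul, map_mul, map_C, this, map_zero, zero_mul]
    · have hsplit : k - ∑ m ∈ k.support, coeff m k • s m
          = ∑ m ∈ k.support, C (coeff m k) * (monomial m 1 - s m) := by
        simp only [mul_sub, C_mul_monomial, mul_one, smul_eq_C_mul, Finset.sum_sub_distrib,
          support_sum_monomial_coeff]
      rw [hsplit]
      exact Ideal.sum_mem _ fun m _ => Ideal.mul_mem_left _ _ (hsI m)
  have hsurj : Function.Surjective (map (σ := Var n) (evalZero K)) :=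
    fun p => ⟨_, map_evalZero_constHom K p⟩
  rw [← map_evalZero_integralIdeal, Ideal.mem_map_iff_of_surjective _ hsurj] at hf
  obtain ⟨g, hg, hgf⟩ := hf
  obtain ⟨s, hs, hs0, hsI⟩ := herr (map (constHom K) f - g) (by
    rw [map_sub, map_evalZero_constHom, hgf, sub_self])
  have hmem : map (constHom K) f - s ∈ integralIdeal K n := by
    have := Ideal.add_mem _ hsI hg
    rwa [sub_right_comm, sub_add_cancel] at this
  have hzero := eq_zero_of_mem_integralPart (integralIdeal_le hmem) (Submodule.sub_mem _
    (fun m hm => hstd (support_map_subset _ _ hm)) hs)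
  have := congrArg (map (evalZero K)) hzero
  rwa [map_sub, map_evalZero_constHom, hs0, sub_zero, map_zero] at this

end ValuationRing

/-! ### Normal forms and the lexicographic initial ideal -/

section Initial

variable {K : Type*} [Field K] {n : ℕ}

theorem exists_standard_sub_mem (K : Type*) [Field K] (m : Var n →₀ ℕ) :
    ∃ m' ∈ standardExponents n, toLex m' ≤ toLex m ∧
      (monomial m 1 - monomial m' 1 : MvPolynomial (Var n) K) ∈ binomialIdeal K n := by
  induction hw : weight m using Nat.strong_induction_on generalizing m with
  | _ N ih =>
    by_cases hstd : m ∈ standardExponents n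
    · exact ⟨m, hstd, le_rfl, by simp⟩
    · simp only [standardExponents, Set.mem_ofPred_eq, not_forall, not_not] at hstd
      obtain ⟨a, b, hab, ham⟩ := hstd
      obtain ⟨r, rfl⟩ := exists_add_of_le ham
      obtain ⟨m', hm', hle, hmem⟩ := ih (weight (b + r)) (by
        rw [← hw, weight_add, weight_add]
        exact Nat.add_lt_add_right hab.weight_lt _) (b + r) rfl
      refine ⟨m', hm', hle.trans ?_, ?_⟩
      · rw [toLex_add, toLex_add]
        exact add_le_add_left hab.lex_lt.le _
      · have hsplit : (monomial (a + r) 1 - monomial m' 1 : MvPolynomial (Var n) K) =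
            monomial r 1 * (monomial a 1 - monomial b 1)
              + (monomial (b + r) 1 - monomial m' 1) := by
          rw [mul_sub, monomial_mul, monomial_mul, add_comm r a, add_comm r b, mul_one]
          ring
        rw [hsplit]
        exact Ideal.add_mem _ (Ideal.mul_mem_left _ _ (exchange_mem_binomialIdeal hab)) hmem

/-- The exponent of the standard monomial that is congruent to a given monomial modulo `Lₙ`. -/
noncomputable def standardForm (K : Type*) [Field K] (m : Var n →₀ ℕ) : Var n →₀ ℕ :=
  (exists_standard_sub_mem K m).choose

theorem standardForm_mem (m : Var n →₀ ℕ) : standardForm K m ∈ standardExponents n :=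
  (exists_standard_sub_mem K m).choose_spec.1

theorem standardForm_le (m : Var n →₀ ℕ) : toLex (standardForm K m) ≤ toLex m :=
  (exists_standard_sub_mem K m).choose_spec.2.1

theorem sub_standardForm_mem (m : Var n →₀ ℕ) :
    (monomial m 1 - monomial (standardForm K m) 1 : MvPolynomial (Var n) K) ∈ binomialIdeal K n :=
  (exists_standard_sub_mem K m).choose_spec.2.2

theorem standardForm_eq_of_sub_mem {m m' : Var n →₀ ℕ} (hm' : m' ∈ standardExponents n)
    (h : (monomial m 1 - monomial m' 1 : MvPolynomial (Var n) K) ∈ binomialIdeal K n) :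
    standardForm K m = m' := by
  have hmem := Ideal.sub_mem _ h (sub_standardForm_mem m)
  rw [sub_sub_sub_cancel_left] at hmem
  have h0 := sub_eq_zero.mp (eq_zero_of_mem_binomialIdeal hmem (Submodule.sub_mem _
    ((monomial_mem_restrictSupport K).mpr (Or.inl (standardForm_mem m)))
    ((monomial_mem_restrictSupport K).mpr (Or.inl hm'))))
  exact monomial_left_injective one_ne_zero h0

theorem standardForm_eq_self {m : Var n →₀ ℕ} (hm : m ∈ standardExponents n) :
    standardForm K m = m :=
  standardForm_eq_of_sub_mem hm (by simp)

theorem standardForm_add_eq {a b : Var n →₀ ℕ} (h : Exchange a b) (r : Var n →₀ ℕ) :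
    standardForm K (r + a) = standardForm K (r + b) := by
  refine standardForm_eq_of_sub_mem (standardForm_mem _) ?_
  have hmem := Ideal.add_mem _ (Ideal.mul_mem_left _ (monomial r 1)
    (exchange_mem_binomialIdeal (K := K) h)) (sub_standardForm_mem (r + b))
  rw [mul_sub, monomial_mul, monomial_mul, mul_one] at hmem
  simpa using hmem

/-- Reduction to standard monomials with coefficients in an arbitrary ring. -/
noncomputable def normalForm (K : Type*) [Field K] (n : ℕ) (S : Type*) [CommRing S] :
    MvPolynomial (Var n) S →ₗ[S] MvPolynomial (Var n) S :=
  (basisMonomials (Var n) S).constr S fun m => monomial (standardForm K m) 1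

theorem normalForm_monomial {S : Type*} [CommRing S] (m : Var n →₀ ℕ) (c : S) :
    normalForm K n S (monomial m c) = monomial (standardForm K m) c := by
  have h : (monomial m c : MvPolynomial (Var n) S) = c • basisMonomials (Var n) S m := by
    rw [coe_basisMonomials, smul_monomial, smul_eq_mul, mul_one]
  rw [h, map_smul, normalForm, Module.Basis.constr_basis, smul_monomial, smul_eq_mul, mul_one]

theorem normalForm_eq_sum {S : Type*} [CommRing S] (f : MvPolynomial (Var n) S) :
    normalForm K n S f = ∑ m ∈ f.support, monomial (standardForm K m) (coeff m f) := by
  conv_lhs => rw [← support_sum_monomial_coeff f, map_sum]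
  exact Finset.sum_congr rfl fun m _ => normalForm_monomial m _

theorem normalForm_eq_self {S : Type*} [CommRing S] {f : MvPolynomial (Var n) S}
    (hf : f ∈ restrictSupport S (standardExponents n)) : normalForm K n S f = f := by
  conv_rhs => rw [← support_sum_monomial_coeff f]
  rw [normalForm_eq_sum]
  exact Finset.sum_congr rfl fun m hm => by rw [standardForm_eq_self (hf hm)]

/-- Reduction to standard monomials annihilates the binomial ideal over every ring. -/
theorem normalForm_eq_zero {S : Type*} [CommRing S] {f : MvPolynomial (Var n) S}
    (hf : f ∈ Ideal.span {f : MvPolynomial (Var n) S | ∃ a b, Exchange a b ∧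
      f = monomial a 1 - monomial b 1}) : normalForm K n S f = 0 := by
  induction hf using Submodule.span_induction with
  | mem f hf =>
    obtain ⟨a, b, hab, rfl⟩ := hf
    have h := standardForm_add_eq (K := K) hab 0
    rw [zero_add, zero_add] at h
    rw [map_sub, normalForm_monomial, normalForm_monomial, h, sub_self]
  | zero => exact map_zero _
  | add f g _ _ hf hg => rw [map_add, hf, hg, add_zero]
  | smul p f hf' _ =>
    clear * - hf'
    induction hf' using Submodule.span_induction generalizing p with
    | mem f hf =>
      obtain ⟨a, b, hab, rfl⟩ := hf
      rw [smul_eq_mul]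
      induction p using MvPolynomial.induction_on' with
      | monomial r c =>
        rw [mul_sub, monomial_mul, monomial_mul, map_sub, normalForm_monomial,
          normalForm_monomial, standardForm_add_eq hab, sub_self]
      | add p q hp hq => rw [add_mul, map_add, hp, hq, add_zero]
    | zero => rw [smul_zero, map_zero]
    | add f g _ _ hf hg => rw [smul_add, map_add, hf, hg, add_zero]
    | smul q f _ hf => rw [smul_smul]; exact hf _

theorem normalForm_eq_zero_of_mem {f : MvPolynomial (Var n) K} (hf : f ∈ binomialIdeal K n) :
    normalForm K n K f = 0 := by
  rw [binomialIdeal_eq_span] at hf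
  exact normalForm_eq_zero hf

/-- The leading monomial of a member of `Lₙ` is not standard: otherwise it would survive the
reduction to standard monomials, which does not increase exponents. -/
theorem degree_not_mem_standardExponents {f : MvPolynomial (Var n) K} (hf : f ∈ binomialIdeal K n)
    (hf0 : f ≠ 0) : MonomialOrder.lex.degree f ∉ standardExponents n := by
  classical
  intro hstd
  have hd := MonomialOrder.lex.degree_mem_support hf0
  have hcoeff := congrArg (coeff (MonomialOrder.lex.degree f)) (normalForm_eq_zero_of_mem hf)
  rw [normalForm_eq_sum, coeff_sum, Finset.sum_eq_single (MonomialOrder.lex.degree f),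
    standardForm_eq_self hstd, coeff_monomial, if_pos rfl, coeff_zero] at hcoeff
  · exact mem_support_iff.mp hd hcoeff
  · intro m hm hne
    rw [coeff_monomial, if_neg]
    intro heq
    have h1 : toLex m ≤ toLex (MonomialOrder.lex.degree f) := MonomialOrder.lex.le_degree hm
    have h2 := standardForm_le (K := K) m
    rw [heq] at h2
    exact hne (toLex.injective (le_antisymm h1 h2))
  · exact fun h => absurd hd h

theorem leadingTerm_exchange {a b : Var n →₀ ℕ} (h : Exchange a b) :
    MonomialOrder.lex.leadingTerm (monomial a 1 - monomial b 1 : MvPolynomial (Var n) K)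
      = monomial a 1 := by
  classical
  have hdeg : MonomialOrder.lex.degree (monomial a 1 - monomial b 1 : MvPolynomial (Var n) K)
      = a := by
    rw [MonomialOrder.degree_sub_of_lt]
    · simp [MonomialOrder.degree_monomial]
    · simpa [MonomialOrder.degree_monomial, MonomialOrder.lex_lt_iff] using h.lex_lt
  have hne : b ≠ a := fun hba => h.lex_lt.ne (congrArg toLex hba)
  rw [MonomialOrder.leadingTerm, MonomialOrder.leadingCoeff, hdeg, coeff_sub, coeff_monomial,
    coeff_monomial, if_pos rfl, if_neg hne, sub_zero]

theorem initialIdeal_eq :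
    initialIdeal MonomialOrder.lex (binomialIdeal K n) = monomialIdeal K n := by
  apply le_antisymm
  · rw [initialIdeal, Ideal.span_le]
    rintro _ ⟨f, hf, rfl⟩
    by_cases hf0 : f = 0
    · simp [hf0]
    · exact monomial_mem_monomialIdeal (degree_not_mem_standardExponents hf hf0) _
  · rw [monomialIdeal_eq_span, Ideal.span_le]
    rintro _ ⟨a, b, hab, rfl⟩
    exact Ideal.subset_span ⟨_, exchange_mem_binomialIdeal hab, leadingTerm_exchange hab⟩

end Initial

/-! ### The weight degeneration of the binomial ideal -/

section WeightDegeneration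

variable {K : Type*} [Field K] {n : ℕ}

/-- The substitution `v ↦ r ^ w v * v` multiplies a monomial by `r` to the power of its weight. -/
theorem rescale_monomial {R : Type*} [CommRing R] (r : R) (m : Var n →₀ ℕ) (c : R) :
    rescale (fun v => r ^ unknownWeight n v) (monomial m c) = monomial m (r ^ weight m * c) := by
  rw [rescale, aeval_monomial, weight, Finsupp.weight_apply, Finsupp.sum,
    ← Finset.prod_pow_eq_pow_sum, monomial_eq (s := m), mul_comm _ c, C_mul, map_prod, mul_assoc]
  simp only [Finsupp.prod, mul_pow, Finset.prod_mul_distrib, algebraMap_eq, map_pow, smul_eq_mul,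
    pow_mul']

/-- The member of the weight family that specializes to the binomial of an exchange at `t = 1`
and to its first monomial at `t = 0`. -/
noncomputable def weightBinomial (K : Type*) [Field K] (a b : Var n →₀ ℕ) :
    MvPolynomial (Var n) (Polynomial K) :=
  monomial a 1 - monomial b (Polynomial.X ^ (weight a - weight b))

theorem pow_weight_mul_pow {R : Type*} [CommRing R] (r : R) {a b : Var n →₀ ℕ}
    (h : Exchange a b) : r ^ weight b * r ^ (weight a - weight b) = r ^ weight a := by
  rw [← pow_add, Nat.add_sub_cancel' h.weight_lt.le]

theorem map_C_binomialIdeal : (binomialIdeal K n).map (map (Polynomial.C : K →+* Polynomial K)) =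
    Ideal.span {f | ∃ a b, Exchange a b ∧ f = monomial a 1 - monomial b 1} := by
  rw [binomialIdeal_eq_span, Ideal.map_span]
  congr 1
  ext f
  constructor
  · rintro ⟨_, ⟨a, b, hab, rfl⟩, rfl⟩
    exact ⟨a, b, hab, by simp⟩
  · rintro ⟨a, b, hab, rfl⟩
    exact ⟨_, ⟨a, b, hab, rfl⟩, by simp⟩

theorem span_weightBinomial_le :
    Ideal.span {f | ∃ a b : Var n →₀ ℕ, Exchange a b ∧ f = weightBinomial K a b} ≤
      weightFamily (unknownWeight n) (binomialIdeal K n) := by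
  rw [Ideal.span_le]
  rintro _ ⟨a, b, hab, rfl⟩
  change rescale (fun v => (Polynomial.X : Polynomial K) ^ unknownWeight n v) _ ∈
    (binomialIdeal K n).map _
  rw [weightBinomial, map_sub, rescale_monomial, rescale_monomial, pow_weight_mul_pow _ hab,
    map_C_binomialIdeal, mul_one]
  have hsplit : (monomial a (Polynomial.X ^ weight a) - monomial b (Polynomial.X ^ weight a) :
      MvPolynomial (Var n) (Polynomial K)) =
      C (Polynomial.X ^ weight a) * (monomial a 1 - monomial b 1) := by
    rw [mul_sub, C_mul_monomial, C_mul_monomial, mul_one]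
  rw [hsplit]
  exact Ideal.mul_mem_left _ _ (Ideal.subset_span ⟨a, b, hab, rfl⟩)

theorem restrictSupport_sup_weightBinomial :
    restrictSupport (Polynomial K) (standardExponents n) ⊔
      (Ideal.span {f | ∃ a b : Var n →₀ ℕ, Exchange a b ∧
        f = weightBinomial K a b}).restrictScalars (Polynomial K) = ⊤ := by
  refine restrictSupport_sup_eq_top bot_le fun a b hab => ?_
  refine ⟨Polynomial.X ^ (weight a - weight b), 0, Ideal.zero_mem _, 0,
    isHomogeneous_zero _ _ _, ?_⟩
  rw [mul_zero, add_zero]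
  exact Ideal.subset_span ⟨a, b, hab, rfl⟩

theorem coeff_rescale {R : Type*} [CommRing R] (r : R) (m : Var n →₀ ℕ)
    (f : MvPolynomial (Var n) R) :
    coeff m (rescale (fun v => r ^ unknownWeight n v) f) = r ^ weight m * coeff m f := by
  classical
  induction f using MvPolynomial.induction_on' with
  | monomial a c =>
    rw [rescale_monomial, coeff_monomial, coeff_monomial]
    split_ifs with h
    · rw [h]
    · rw [mul_zero]
  | add p q hp hq => rw [map_add, coeff_add, coeff_add, hp, hq, mul_add]

/-- The standard monomials are linearly independent modulo the weight family: the substitution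
multiplies each of them by a power of `t`, and the extension of `Lₙ` to `K[t]` has the same
reduction to standard monomials as `Lₙ`. -/
theorem eq_zero_of_mem_weightFamily {f : MvPolynomial (Var n) (Polynomial K)}
    (hf : f ∈ weightFamily (unknownWeight n) (binomialIdeal K n))
    (hstd : f ∈ restrictSupport (Polynomial K) (standardExponents n)) : f = 0 := by
  have hf' : rescale (fun v => (Polynomial.X : Polynomial K) ^ unknownWeight n v) f ∈
      (binomialIdeal K n).map (map (Polynomial.C : K →+* Polynomial K)) := hf
  rw [map_C_binomialIdeal] at hf'
  have h0 := normalForm_eq_zero (K := K) hf'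
  rw [normalForm_eq_self] at h0
  · ext1 m
    have := congrArg (coeff m) h0
    rw [coeff_rescale, coeff_zero] at this
    exact (mul_eq_zero.mp this).resolve_left (pow_ne_zero _ Polynomial.X_ne_zero)
  · intro m hm
    have hne : coeff m (rescale (fun v => (Polynomial.X : Polynomial K) ^ unknownWeight n v) f)
        ≠ 0 := mem_support_iff.mp hm
    rw [coeff_rescale] at hne
    exact hstd (mem_support_iff.mpr (right_ne_zero_of_mul hne))

/-- The weight family is generated by the homogenized binomials. -/
theorem weightFamily_eq_span : weightFamily (unknownWeight n) (binomialIdeal K n) =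
    Ideal.span {f | ∃ a b : Var n →₀ ℕ, Exchange a b ∧ f = weightBinomial K a b} := by
  refine le_antisymm (fun f hf => ?_) span_weightBinomial_le
  obtain ⟨s, hs, g, hg, rfl⟩ := Submodule.mem_sup.mp
    (restrictSupport_sup_weightBinomial.ge (Submodule.mem_top (x := f)))
  have hs' := (Ideal.add_mem_iff_left _ (span_weightBinomial_le hg)).mp hf
  rw [eq_zero_of_mem_weightFamily hs' hs, zero_add]
  exact hg

theorem flat_weightFamily : Module.Flat (Polynomial K) (MvPolynomial (Var n) (Polynomial K) ⧸
    weightFamily (unknownWeight n) (binomialIdeal K n)) := by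
  refine flat_quotient_of_isCompl ⟨Submodule.disjoint_def.mpr fun f hstd hf =>
    eq_zero_of_mem_weightFamily hf hstd, codisjoint_iff.mpr ?_⟩
  rw [weightFamily_eq_span]
  exact restrictSupport_sup_weightBinomial

theorem fiberAt_weightFamily (c : K) :
    fiberAt c (weightFamily (unknownWeight n) (binomialIdeal K n)) =
      Ideal.span {f | ∃ a b : Var n →₀ ℕ, Exchange a b ∧
        f = monomial a 1 - monomial b (c ^ (weight a - weight b))} := by
  rw [fiberAt, weightFamily_eq_span, Ideal.map_span]
  congr 1
  ext f
  constructor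
  · rintro ⟨_, ⟨a, b, hab, rfl⟩, rfl⟩
    exact ⟨a, b, hab, by simp [weightBinomial]⟩
  · rintro ⟨a, b, hab, rfl⟩
    exact ⟨_, ⟨a, b, hab, rfl⟩, by simp [weightBinomial]⟩

theorem fiberAt_zero_weightFamily :
    fiberAt 0 (weightFamily (unknownWeight n) (binomialIdeal K n)) = monomialIdeal K n := by
  rw [fiberAt_weightFamily, monomialIdeal_eq_span]
  congr 1
  ext f
  refine exists_congr fun a => exists_congr fun b => and_congr_right fun hab => ?_
  rw [zero_pow (Nat.sub_ne_zero_of_lt hab.weight_lt), monomial_zero, sub_zero]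

theorem fiberAt_weightFamily_of_ne_zero {c : K} (hc : c ≠ 0) :
    fiberAt c (weightFamily (unknownWeight n) (binomialIdeal K n)) =
      (binomialIdeal K n).comap (rescale (fun v => c ^ unknownWeight n v)).toRingHom := by
  rw [fiberAt_weightFamily]
  apply le_antisymm
  · rw [Ideal.span_le]
    rintro _ ⟨a, b, hab, rfl⟩
    change rescale (fun v => c ^ unknownWeight n v) _ ∈ binomialIdeal K n
    have hsplit : (monomial a (c ^ weight a) - monomial b (c ^ weight a) :
        MvPolynomial (Var n) K) = C (c ^ weight a) * (monomial a 1 - monomial b 1) := by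
      rw [mul_sub, C_mul_monomial, C_mul_monomial, mul_one]
    rw [map_sub, rescale_monomial, rescale_monomial, pow_weight_mul_pow _ hab, mul_one, hsplit]
    exact Ideal.mul_mem_left _ _ (exchange_mem_binomialIdeal hab)
  · intro f hf
    have hf' : rescale (fun v => c ^ unknownWeight n v) f ∈ binomialIdeal K n := hf
    have hinv : rescale (fun v => c⁻¹ ^ unknownWeight n v)
        (rescale (fun v => c ^ unknownWeight n v) f) = f := by
      ext1 m
      rw [coeff_rescale, coeff_rescale, ← mul_assoc, ← mul_pow, inv_mul_cancel₀ hc, one_pow,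
        one_mul]
    rw [← hinv]
    -- The inverse substitution carries the generators of `Lₙ` to multiples of those of the fiber.
    have hle : (binomialIdeal K n).map (rescale (fun v => c⁻¹ ^ unknownWeight n v)) ≤
        Ideal.span {f | ∃ a b : Var n →₀ ℕ, Exchange a b ∧
          f = monomial a 1 - monomial b (c ^ (weight a - weight b))} := by
      rw [binomialIdeal_eq_span, Ideal.map_span, Ideal.span_le]
      rintro _ ⟨_, ⟨a, b, hab, rfl⟩, rfl⟩
      have hsplit : (monomial a (c⁻¹ ^ weight a) - monomial b (c⁻¹ ^ weight b) :
          MvPolynomial (Var n) K) = C (c⁻¹ ^ weight a) *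
            (monomial a 1 - monomial b (c ^ (weight a - weight b))) := by
        rw [mul_sub, C_mul_monomial, C_mul_monomial, mul_one, ← pow_weight_mul_pow c⁻¹ hab,
          mul_assoc, ← mul_pow, inv_mul_cancel₀ hc, one_pow, mul_one]
      rw [map_sub, rescale_monomial, rescale_monomial, mul_one, mul_one, hsplit]
      exact Ideal.mul_mem_left _ _ (Ideal.subset_span ⟨a, b, hab, rfl⟩)
    exact hle (Ideal.mem_map_of_mem _ hf')

end WeightDegeneration

end Multiview

theorem theorem5p1 (K : Type*) [Field K] (n : ℕ) (hn : 2 ≤ n) :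
    -- the multiview ideal is generated by the quadrics and the trinomial cubics
    Multiview.multiviewIdeal (Multiview.collinearCameras K n)
        = Ideal.span (Multiview.quadricsAndCubics K n) ∧
    -- its special fiber at `ε = 0` is the binomial ideal
    Multiview.specialFiber (Multiview.multiviewIdeal (Multiview.collinearCameras K n))
        = Multiview.binomialIdeal K n ∧
    -- whose lexicographic initial ideal is the monomial ideal
    Multiview.initialIdeal MonomialOrder.lex (Multiview.binomialIdeal K n)
        = Multiview.monomialIdeal K n ∧
    -- the first degeneration is flat over the valuation ring, with the multiview ideal as its
    -- generic fiber
    (Module.Flat (Multiview.valRing K)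
        (MvPolynomial (Multiview.Var n) (Multiview.valRing K) ⧸
          Multiview.integralPart (Multiview.multiviewIdeal (Multiview.collinearCameras K n))) ∧
      (Multiview.integralPart (Multiview.multiviewIdeal (Multiview.collinearCameras K n))).map
          (MvPolynomial.map (Multiview.valRing K).subtype)
        = Multiview.multiviewIdeal (Multiview.collinearCameras K n)) ∧
    -- the second degeneration is flat over the affine line; away from `0` its fibers differ from
    -- the binomial ideal by a rescaling of the unknowns, and its fiber at `0` is the monomial ideal
    ∃ w : Multiview.Var n → ℕ,
      Module.Flat (Polynomial K)
        (MvPolynomial (Multiview.Var n) (Polynomial K) ⧸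
          Multiview.weightFamily w (Multiview.binomialIdeal K n)) ∧
      (∀ c : K, c ≠ 0 →
        Multiview.fiberAt c (Multiview.weightFamily w (Multiview.binomialIdeal K n))
          = (Multiview.binomialIdeal K n).comap
              (Multiview.rescale (fun v => c ^ w v)).toRingHom) ∧
      Multiview.fiberAt 0 (Multiview.weightFamily w (Multiview.binomialIdeal K n))
        = Multiview.monomialIdeal K n := by
  exact ⟨Multiview.multiviewIdeal_eq_span, Multiview.specialFiber_eq, Multiview.initialIdeal_eq,
    ⟨Multiview.flat_integralPart, Multiview.map_integralPart⟩, Multiview.unknownWeight n,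
    Multiview.flat_weightFamily, fun _ hc => Multiview.fiberAt_weightFamily_of_ne_zero hc,
    Multiview.fiberAt_zero_weightFamily⟩
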